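/- Let $V$ be a complex vector space with a bilinear product $(x,y)\mapsto xy$, and put $(x,y,z)=(xy)z-x(yz)$ and $R_x(y)=yx$. The product is *left-symmetric* if $(x,y,z)=(y,x,z)$ for all $x,y,z$. A left-symmetric algebra is *associative* if all $(x,y,z)=0$; *transitive* if every $R_x$ is nilpotent; *Novikov* if $R_xR_y=R_yR_x$ for all $x,y$; *bi-symmetric* if $(x,y,z)=(x,z,y)$ for all $x,y,z$. It is *simple* if it is nonzero and has no (two-sided) ideals except itself and zero, and *semisimple* if it is the direct sum of finitely many ideals that are simple algebras. Let $\mathcal N=\langle e_1,e_2,e_3\mid [e_3,e_2]=e_2\rangle$ be the three-dimensional complex Lie algebra whose other brackets of basis vectors (apart from $[e_2,e_3]=-e_2$) are zero. A *left-symmetric algebra on $\mathcal N$* is a left-symmetric bilinear product on the vector space $\mathcal N$ with $xy-yx=[x,y]$ for all $x,y$. Isomorphism means isomorphism of algebras. Consider the following products on $\mathcal N$; rows are separated by semicolons, the entry in row $i$ and column $j$ is $e_ie_j$, and parameters are arbitrary complex numbers subject to the restrictions shown. - (N-1)$_\lambda$: $(0,0,0;\ 0,0,0;\ 0,e_2,\lambda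 e_3)$ - (N-2)$_{\lambda,\mu}$: $(e_1+\frac{\lambda(\lambda-1)}{\mu}e_3,0,\lambda e_3;\ 0,0,0;\ \lambda e_3,e_2,\mu e_3)$, $\lambda\ne0$, $\mu\neq 0$ - (N-3)$_\mu$: $(e_1,0,0;\ 0,0,0;\ 0,e_2,\mu e_3)$, $\mu\ne0$ - (N-4)$_\lambda$: $(e_1+\lambda e_3,0,0;\ 0,0,0;\ 0,e_2,0)$ - (N-5): $(0,0,0;\ 0,0,0;\ 0,e_2,e_1)$ - (N-6): $(0,0,0;\ 0,0,0;\ 0,e_2,e_3+e_2)$ - (N-7): $(e_1,0,0;\ 0,0,0;\ 0,e_2,e_3+e_2)$ - (N-8): $(e_1,0,e_3;\ 0,0,0;\ e_3,e_2,0)$ - (N-9)$_\lambda$: $(0,0,\lambda e_1;\ 0,0,0;\ \lambda e_1,e_2,\lambda e_3)$, $\lambda\ne0$ - (N-10): $(e_3,0,0;\ 0,0,0;\ 0,e_2,0)$ - (N-11): $(0,0,e_2;\ 0,0,0;\ e_2,e_2,e_3)$ - (N-12): $(0,0,e_2;\ 0,0,0;\ e_2,e_2,e_3-e_2)$ - (N-13)$_\lambda$: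 $(e_1-e_2,0,e_2;\ 0,0,0;\ e_2,e_2,e_3-\lambda e_2)$ - (N-14)$_\lambda$: $(e_1-\frac1\lambda e_3,0,e_3;\ 0,0,0;\ e_3,e_2,0)$, $\lambda\ne0$ - (N-15): $(0,0,e_1;\ 0,0,0;\ e_1,e_2,e_3+e_2)$ - (N-16): $(e_2,0,e_1;\ 0,0,0;\ e_1,e_2,e_3)$ - (N-17): $(e_2,0,e_1;\ 0,0,0;\ e_1,e_2,e_3+e_2)$ - (N-18)$_\lambda$: $(0,0,0;\ 0,0,\lambda e_2;\ 0,(\lambda+1)e_2,\lambda e_3)$, $\lambda\ne0$ - (N-19): $(0,0,0;\ 0,0,-e_2;\ 0,0,-e_3+e_2)$ - (N-20): $(0,0,0;\ 0,e_3,0;\ 0,e_2,2e_3)$ - (N-21): $(0,0,0;\ 0,0,e_1;\ 0,e_2+e_1,-e_3)$ - (N-22)$_{\lambda,\mu}$: $(e_1+\frac{\lambda(\lambda-1)}{\mu}e_3,e_2,\lambda e_3;\ e_2,0,0;\ \lambda e_3,e_2,\mu e_3)$, $\lambda\ne0$, $\mu\ne0$ - (N-23)$_\mu$: $(e_1,e_2,0;\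 e_2,0,0;\ 0,e_2,\mu e_3)$, $\mu\ne0,1$ - (N-24)$_\lambda$: $(e_1+\lambda e_3,e_2,0;\ e_2,0,0;\ 0,e_2,0)$ - (N-25)$_\lambda$: $(e_1,e_2+\lambda e_3,0;\ e_2+\lambda e_3,0,0;\ 0,e_2,e_3)$ - (N-26)$_\lambda$: $(e_1,0,0;\ 0,0,\lambda e_2;\ 0,(\lambda+1)e_2,\lambda e_3)$, $\lambda\ne0$ - (N-27): $(e_1,0,0;\ 0,0,-e_2;\ 0,0,-e_3+e_2)$ - (N-28): $(e_1+e_2,0,0;\ 0,0,-e_2;\ 0,0,-e_3)$ - (N-29): $(e_1+e_2,0,0;\ 0,0,-e_2;\ 0,0,-e_3+e_2)$ - (N-30): $(e_1,0,0;\ 0,e_3,0;\ 0,e_2,2e_3)$ - (N-31): $(e_1,e_2,e_3;\ e_2,0,0;\ e_3,e_2,e_3+e_2)$ - (N-32): $(e_1,e_2,e_3;\ e_2,0,0;\ e_3,e_2,0)$ - (N-33): $(e_2,0,0;\ 0,0,-e_2;\ 0,0,-e_3)$ - (N-34): $(e_2,0,0;\ 0,0,-e_2;\ 0,0,-e_3+e_2)$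 - (N-35): $(0,e_3,0;\ e_3,0,0;\ 0,e_2,e_3)$ - (N-36): $(0,0,2e_1;\ 0,e_1,0;\ 2e_1,e_2,2e_3)$ - (N-37)$_\lambda$: $(e_1+e_2,e_2,e_2+e_3;\ e_2,0,0;\ e_2+e_3,e_2,e_3-\lambda e_2)$ - (N-38)$_\lambda$: $(0,0,\lambda e_1;\ 0,0,\lambda e_2;\ \lambda e_1,(\lambda+1)e_2,\lambda e_3)$, $\lambda\ne0$ - (N-39): $(0,0,-e_1;\ 0,0,-e_2;\ -e_1,0,-e_3+e_2)$ - (N-40): $(0,0,-e_1+e_2;\ 0,0,-e_2;\ -e_1+e_2,0,-e_3)$ - (N-41): $(0,0,-e_1+e_2;\ 0,0,-e_2;\ -e_1+e_2,0,-e_3+e_2)$ - (N-42): $(0,0,e_1;\ 0,0,e_2-e_1;\ e_1,2e_2-e_1,e_3)$ - (N-43)$_\lambda$: $(e_1-\frac1\lambda e_3,e_2,e_3;\ e_2,0,0;\ e_3,e_2,0)$, $\lambda\ne0$ - (N-44): $(0,0,0;\ 0,e_1,-2e_2;\ 0,-e_2,-2e_3)$ - (N-45): $(e_1,e_2,e_3;\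 e_2,e_3,0;\ e_3,e_2,2e_3)$ All of these are left-symmetric algebras on $\mathcal N$. Among them, the associative, transitive, Novikov and bi-symmetric ones are exactly those in the lists a)–d) below; moreover, an arbitrary left-symmetric algebra on $\mathcal N$ is associative (respectively transitive, Novikov, bi-symmetric) if and only if it is isomorphic to a member of the list a) (respectively b), c), d)). a) Associative: (N-1)$_1$, (N-3)$_1$, (N-9)$_1$, (N-18)$_{-1}$, (N-22)$_{1,1}$, (N-26)$_{-1}$, (N-38)$_{-1}$. b) Transitive: (N-1)$_0$, (N-5), (N-10). c) Novikov: (N-1)$_0$, (N-4)$_0$, (N-5), (N-18)$_\lambda$ ($\lambda\ne0$), (N-19), (N-26)$_\lambda$ ($\lambda\ne0$), (N-27), (N-38)$_\lambda$ ($\lambda\ne0$), (N-39). d) Bi-symmetric: (N-1)$_1$, (N-3)$_1$, (N-6), (N-7), (N-9)$_1$, (N-15), (N-18)$_{-1}$, (N-19), (N-22)$_{1,1}$, (N-26)$_{-1}$, (N-27), (N-31), (N-38)$_{-1}$, (N-39). e) No left-symmetric algebra on $\mathcal N$ is simple, but (N-30) is semisimple. -/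

import Mathlib

/-! ### Algebras given by a bilinear product -/

section General

variable {k V W : Type*} [Field k] [AddCommGroup V] [Module k V] [AddCommGroup W] [Module k W]

/-- The associator `(x, y, z) = (xy)z - x(yz)` of a bilinear product. -/
def prodAssociator (μ : V →ₗ[k] V →ₗ[k] V) (x y z : V) : V :=
  μ (μ x y) z - μ x (μ y z)

/-- Left-symmetric: `(x, y, z) = (y, x, z)`. -/
def IsLeftSymmetric (μ : V →ₗ[k] V →ₗ[k] V) : Prop :=
  ∀ x y z : V, prodAssociator μ x y z = prodAssociator μ y x z

/-- Associative: every associator vanishes. -/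
def IsAssociativeProd (μ : V →ₗ[k] V →ₗ[k] V) : Prop :=
  ∀ x y z : V, μ (μ x y) z = μ x (μ y z)

/-- The right multiplication operator `R_x : y ↦ yx`. -/
def rightMul (μ : V →ₗ[k] V →ₗ[k] V) (x : V) : Module.End k V :=
  μ.flip x

/-- Transitive (complete): every right multiplication is nilpotent. -/
def IsTransitiveProd (μ : V →ₗ[k] V →ₗ[k] V) : Prop :=
  ∀ x : V, IsNilpotent (rightMul μ x)

/-- The Novikov condition: the right multiplications commute. -/
def IsNovikovProd (μ : V →ₗ[k] V →ₗ[k] V) : Prop :=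
  ∀ x y : V, rightMul μ x * rightMul μ y = rightMul μ y * rightMul μ x

/-- The bi-symmetric condition: the associator is also right-symmetric. -/
def IsBisymmetricProd (μ : V →ₗ[k] V →ₗ[k] V) : Prop :=
  ∀ x y z : V, prodAssociator μ x y z = prodAssociator μ x z y

/-- Two-sided ideals. -/
def IsIdealProd (μ : V →ₗ[k] V →ₗ[k] V) (I : Submodule k V) : Prop :=
  ∀ x : V, ∀ y ∈ I, μ x y ∈ I ∧ μ y x ∈ I

/-- A nonzero algebra is simple if its only ideals are zero and itself. -/
def IsSimpleProd (μ : V →ₗ[k] V →ₗ[k] V) : Prop :=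
  Nontrivial V ∧ ∀ I : Submodule k V, IsIdealProd μ I → I = ⊥ ∨ I = ⊤

/-- An ideal, as an algebra with the restricted product. -/
def idealProd (μ : V →ₗ[k] V →ₗ[k] V) (I : Submodule k V) (hI : IsIdealProd μ I) :
    I →ₗ[k] I →ₗ[k] I :=
  LinearMap.mk₂ k (fun x y : I => (⟨μ x y, (hI x y y.2).1⟩ : I))
    (fun x x' y => Subtype.ext (by simp))
    (fun c x y => Subtype.ext (by simp))
    (fun x y y' => Subtype.ext (by simp))
    (fun c x y => Subtype.ext (by simp))

/-- An algebra is semisimple if it is the direct sum of (finitely many) ideals, each of which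
is a simple algebra. -/
def IsSemisimpleProd (μ : V →ₗ[k] V →ₗ[k] V) : Prop :=
  ∃ (n : ℕ) (I : Fin n → Submodule k V) (hI : ∀ i, IsIdealProd μ (I i)),
    DirectSum.IsInternal I ∧ ∀ i, IsSimpleProd (idealProd μ (I i) (hI i))

/-- Isomorphism of algebras. -/
def IsomorphicProd (μ : V →ₗ[k] V →ₗ[k] V) (ν : W →ₗ[k] W →ₗ[k] W) : Prop :=
  ∃ F : V ≃ₗ[k] W, ∀ x y : V, F (μ x y) = ν (F x) (F y)

end General

/-- `μ` is a left-symmetric algebra on the Lie algebra `G`: it is a left-symmetric product on the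
vector space `G` whose commutator is the Lie bracket of `G`. -/
def IsLeftSymmetricOn {k G : Type*} [Field k] [LieRing G] [LieAlgebra k G]
    (μ : G →ₗ[k] G →ₗ[k] G) : Prop :=
  IsLeftSymmetric μ ∧ ∀ x y : G, μ x y - μ y x = ⁅x, y⁆

/-! ### The Lie algebra `N` -/

/-- The underlying space of the complex Lie algebra `N = ⟨e₁, e₂, e₃ | [e₃, e₂] = e₂⟩`. -/
def LieN : Type := Fin 3 → ℂ

namespace LieN

noncomputable instance : AddCommGroup LieN := inferInstanceAs (AddCommGroup (Fin 3 → ℂ))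
noncomputable instance : Module ℂ LieN := inferInstanceAs (Module ℂ (Fin 3 → ℂ))

/-- The coordinates with respect to the basis `e₁, e₂, e₃`, indexed by `0, 1, 2`. -/
noncomputable def coord : LieN ≃ₗ[ℂ] (Fin 3 → ℂ) := LinearEquiv.refl ℂ (Fin 3 → ℂ)

/-- The basis vectors of `N`. -/
noncomputable def e₁ : LieN := coord.symm ![1, 0, 0]
noncomputable def e₂ : LieN := coord.symm ![0, 1, 0]
noncomputable def e₃ : LieN := coord.symm ![0, 0, 1]

@[simp] theorem coord_e₁ : coord e₁ = ![1, 0, 0] := coord.apply_symm_apply _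
@[simp] theorem coord_e₂ : coord e₂ = ![0, 1, 0] := coord.apply_symm_apply _
@[simp] theorem coord_e₃ : coord e₃ = ![0, 0, 1] := coord.apply_symm_apply _

@[ext] theorem ext {x y : LieN} (h : ∀ i, coord x i = coord y i) : x = y :=
  coord.injective (funext h)

/-- The bilinear bracket with `[e₃, e₂] = e₂ = -[e₂, e₃]`, all other brackets of basis vectors
being zero. -/
noncomputable instance : Bracket LieN LieN :=
  ⟨fun x y => (coord x 2 * coord y 1 - coord x 1 * coord y 2) • e₂⟩

theorem bracket_def (x y : LieN) :
    ⁅x, y⁆ = (coord x 2 * coord y 1 - coord x 1 * coord y 2) • e₂ := rfl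

noncomputable instance : LieRing LieN where
  add_lie x y z := by
    simp only [bracket_def, map_add, Pi.add_apply, ← add_smul]; congr 1; ring
  lie_add x y z := by
    simp only [bracket_def, map_add, Pi.add_apply, ← add_smul]; congr 1; ring
  lie_self x := by
    rw [bracket_def, mul_comm, sub_self, zero_smul]
  leibniz_lie x y z := by
    simp only [bracket_def, map_smul, Pi.smul_apply, smul_eq_mul, ← add_smul, coord_e₂]
    congr 1
    simp
    ring

noncomputable instance : LieAlgebra ℂ LieN where
  lie_smul c x y := by
    simp only [bracket_def, map_smul, Pi.smul_apply, smul_eq_mul, smul_smul]; congr 1; ring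

/-- The bilinear product with characteristic matrix `M`, that is, with `eᵢ eⱼ = M i j`. -/
noncomputable def ofMatrix (M : Matrix (Fin 3) (Fin 3) LieN) : LieN →ₗ[ℂ] LieN →ₗ[ℂ] LieN :=
  LinearMap.mk₂ ℂ (fun x y => ∑ i, ∑ j, (coord x i * coord y j) • M i j)
    (fun x x' y => by simp only [map_add, Pi.add_apply, add_mul, add_smul, Finset.sum_add_distrib])
    (fun c x y => by simp only [map_smul, Pi.smul_apply, smul_eq_mul, mul_assoc, mul_smul, Finset.smul_sum])
    (fun x y y' => by simp only [map_add, Pi.add_apply, mul_add, add_smul, Finset.sum_add_distrib])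
    (fun c x y => by
      simp only [map_smul, Pi.smul_apply, smul_eq_mul, mul_left_comm _ c, mul_smul, Finset.smul_sum])

end LieN

/-! ### The 45 families of left-symmetric algebras on `N` -/

/-- The names of the algebras: `n1 a` is the algebra (N-1) with parameter `a`, and so on. -/
inductive NName : Type
  | n1 (a : ℂ) | n2 (a b : ℂ) | n3 (b : ℂ) | n4 (a : ℂ) | n5 | n6 | n7 | n8 | n9 (a : ℂ)
  | n10 | n11 | n12 | n13 (a : ℂ) | n14 (a : ℂ) | n15 | n16 | n17 | n18 (a : ℂ) | n19 | n20
  | n21 | n22 (a b : ℂ) | n23 (b : ℂ) | n24 (a : ℂ) | n25 (a : ℂ) | n26 (a : ℂ) | n27 | n28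
  | n29 | n30 | n31 | n32 | n33 | n34 | n35 | n36 | n37 (a : ℂ) | n38 (a : ℂ) | n39 | n40
  | n41 | n42 | n43 (a : ℂ) | n44 | n45

namespace NName

open LieN

/-- The range of the parameters; families that are not mentioned have no restriction. -/
def Admissible : NName → Prop
  | n2 a b => a ≠ 0 ∧ b ≠ 0
  | n3 b => b ≠ 0
  | n9 a => a ≠ 0
  | n14 a => a ≠ 0
  | n18 a => a ≠ 0
  | n22 a b => a ≠ 0 ∧ b ≠ 0
  | n23 b => b ≠ 0 ∧ b ≠ 1
  | n26 a => a ≠ 0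
  | n38 a => a ≠ 0
  | n43 a => a ≠ 0
  | _ => True

/-- The characteristic matrix; the entry in row `i` and column `j` is `eᵢ eⱼ`. -/
noncomputable def charMatrix : NName → Matrix (Fin 3) (Fin 3) LieN
  | n1 a => !![0, 0, 0; 0, 0, 0; 0, e₂, a • e₃]
  | n2 a b => !![e₁ + (a * (a - 1) / b) • e₃, 0, a • e₃; 0, 0, 0; a • e₃, e₂, b • e₃]
  | n3 b => !![e₁, 0, 0; 0, 0, 0; 0, e₂, b • e₃]
  | n4 a => !![e₁ + a • e₃, 0, 0; 0, 0, 0; 0, e₂, 0]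
  | n5 => !![0, 0, 0; 0, 0, 0; 0, e₂, e₁]
  | n6 => !![0, 0, 0; 0, 0, 0; 0, e₂, e₃ + e₂]
  | n7 => !![e₁, 0, 0; 0, 0, 0; 0, e₂, e₃ + e₂]
  | n8 => !![e₁, 0, e₃; 0, 0, 0; e₃, e₂, 0]
  | n9 a => !![0, 0, a • e₁; 0, 0, 0; a • e₁, e₂, a • e₃]
  | n10 => !![e₃, 0, 0; 0, 0, 0; 0, e₂, 0]
  | n11 => !![0, 0, e₂; 0, 0, 0; e₂, e₂, e₃]
  | n12 => !![0, 0, e₂; 0, 0, 0; e₂, e₂, e₃ - e₂]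
  | n13 a => !![e₁ - e₂, 0, e₂; 0, 0, 0; e₂, e₂, e₃ - a • e₂]
  | n14 a => !![e₁ - (1 / a) • e₃, 0, e₃; 0, 0, 0; e₃, e₂, 0]
  | n15 => !![0, 0, e₁; 0, 0, 0; e₁, e₂, e₃ + e₂]
  | n16 => !![e₂, 0, e₁; 0, 0, 0; e₁, e₂, e₃]
  | n17 => !![e₂, 0, e₁; 0, 0, 0; e₁, e₂, e₃ + e₂]
  | n18 a => !![0, 0, 0; 0, 0, a • e₂; 0, (a + 1) • e₂, a • e₃]
  | n19 => !![0, 0, 0; 0, 0, -e₂; 0, 0, -e₃ + e₂]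
  | n20 => !![0, 0, 0; 0, e₃, 0; 0, e₂, (2 : ℂ) • e₃]
  | n21 => !![0, 0, 0; 0, 0, e₁; 0, e₂ + e₁, -e₃]
  | n22 a b => !![e₁ + (a * (a - 1) / b) • e₃, e₂, a • e₃; e₂, 0, 0; a • e₃, e₂, b • e₃]
  | n23 b => !![e₁, e₂, 0; e₂, 0, 0; 0, e₂, b • e₃]
  | n24 a => !![e₁ + a • e₃, e₂, 0; e₂, 0, 0; 0, e₂, 0]
  | n25 a => !![e₁, e₂ + a • e₃, 0; e₂ + a • e₃, 0, 0; 0, e₂, e₃]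
  | n26 a => !![e₁, 0, 0; 0, 0, a • e₂; 0, (a + 1) • e₂, a • e₃]
  | n27 => !![e₁, 0, 0; 0, 0, -e₂; 0, 0, -e₃ + e₂]
  | n28 => !![e₁ + e₂, 0, 0; 0, 0, -e₂; 0, 0, -e₃]
  | n29 => !![e₁ + e₂, 0, 0; 0, 0, -e₂; 0, 0, -e₃ + e₂]
  | n30 => !![e₁, 0, 0; 0, e₃, 0; 0, e₂, (2 : ℂ) • e₃]
  | n31 => !![e₁, e₂, e₃; e₂, 0, 0; e₃, e₂, e₃ + e₂]
  | n32 => !![e₁, e₂, e₃; e₂, 0, 0; e₃, e₂, 0]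
  | n33 => !![e₂, 0, 0; 0, 0, -e₂; 0, 0, -e₃]
  | n34 => !![e₂, 0, 0; 0, 0, -e₂; 0, 0, -e₃ + e₂]
  | n35 => !![0, e₃, 0; e₃, 0, 0; 0, e₂, e₃]
  | n36 => !![0, 0, (2 : ℂ) • e₁; 0, e₁, 0; (2 : ℂ) • e₁, e₂, (2 : ℂ) • e₃]
  | n37 a => !![e₁ + e₂, e₂, e₂ + e₃; e₂, 0, 0; e₂ + e₃, e₂, e₃ - a • e₂]
  | n38 a => !![0, 0, a • e₁; 0, 0, a • e₂; a • e₁, (a + 1) • e₂, a • e₃]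
  | n39 => !![0, 0, -e₁; 0, 0, -e₂; -e₁, 0, -e₃ + e₂]
  | n40 => !![0, 0, -e₁ + e₂; 0, 0, -e₂; -e₁ + e₂, 0, -e₃]
  | n41 => !![0, 0, -e₁ + e₂; 0, 0, -e₂; -e₁ + e₂, 0, -e₃ + e₂]
  | n42 => !![0, 0, e₁; 0, 0, e₂ - e₁; e₁, (2 : ℂ) • e₂ - e₁, e₃]
  | n43 a => !![e₁ - (1 / a) • e₃, e₂, e₃; e₂, 0, 0; e₃, e₂, 0]
  | n44 => !![0, 0, 0; 0, e₁, -(2 : ℂ) • e₂; 0, -e₂, -(2 : ℂ) • e₃]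
  | n45 => !![e₁, e₂, e₃; e₂, e₃, 0; e₃, e₂, (2 : ℂ) • e₃]

/-- The product of the algebra with the given name. -/
noncomputable def product (c : NName) : LieN →ₗ[ℂ] LieN →ₗ[ℂ] LieN :=
  ofMatrix c.charMatrix

/-- The list of associative algebras. -/
def associativeList : Set NName :=
  {n1 1, n3 1, n9 1, n18 (-1), n22 1 1, n26 (-1), n38 (-1)}

/-- The list of transitive algebras. -/
def transitiveList : Set NName :=
  {n1 0, n5, n10}

/-- The list of Novikov algebras. -/
def novikovList : Set NName :=
  {n1 0, n4 0, n5, n19, n27, n39} ∪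
    {c | ∃ a : ℂ, a ≠ 0 ∧ (c = n18 a ∨ c = n26 a ∨ c = n38 a)}

/-- The list of bi-symmetric algebras. -/
def bisymmetricList : Set NName :=
  {n1 1, n3 1, n6, n7, n9 1, n15, n18 (-1), n19, n22 1 1, n26 (-1), n27, n31, n38 (-1), n39}

end NName

/-! ### Invariance under isomorphism, and reduction of the identities to basis vectors -/

section Transport

variable {k V W : Type*} [Field k] [AddCommGroup V] [Module k V] [AddCommGroup W] [Module k W]

/-! For the named algebras every claim is a finite computation with structure constants.
Associativity implies bi-symmetry, so only the bi-symmetric tables need testing for it; transitivity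
is excluded by traces of right multiplications.

Completeness of the lists rests on two facts: `x ↦ L_x` is a representation of the Lie algebra, and
`e₁` is central, so `L_{e₁} = R_{e₁}` commutes with every `L_x`. In the Novikov and bi-symmetric
cases `L_{e₁}` even lies in the centroid, hence commutes with the adjoint action and is almost
diagonal (`leftMul_e₁_of_centroid`). The remaining identities leave only the tables `splitTable` and
`unitalTable`, and Lie algebra automorphisms bring these to the listed forms. The associative list
is cut out of the bi-symmetric one.

In the transitive case the traces of `R_x` and `R_x R_y` vanish. Comparing them with the traces of
`L_x L_y`, which vanish whenever `x` is `e₁` or `e₂`, gives `L_{e₂} = 0`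
(`leftMul_e₂_of_transitive`), after which the classification is short.

No algebra is simple because `ℂe₂ + e₂N` is a nonzero ideal. Since `[L_{e₃}, L_{e₂}] = L_{e₂}`, the
operator `L_{e₂}` is nilpotent. Were the ideal everything, `e₂` would be a cyclic vector for
`L_{e₂}`, and comparing the commuting operators `L_{e₁}` and `L_{e₃}` on the resulting basis would
force `e₁ = 0`. -/

theorem IsomorphicProd.isAssociativeProd {μ : V →ₗ[k] V →ₗ[k] V} {ν : W →ₗ[k] W →ₗ[k] W}
    (h : IsomorphicProd μ ν) (hν : IsAssociativeProd ν) : IsAssociativeProd μ := by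
  obtain ⟨F, hF⟩ := h
  exact fun x y z => F.injective (by simp only [hF]; exact hν _ _ _)

theorem IsomorphicProd.isBisymmetricProd {μ : V →ₗ[k] V →ₗ[k] V} {ν : W →ₗ[k] W →ₗ[k] W}
    (h : IsomorphicProd μ ν) (hν : IsBisymmetricProd ν) : IsBisymmetricProd μ := by
  obtain ⟨F, hF⟩ := h
  refine fun x y z => F.injective ?_
  simp only [prodAssociator, map_sub, hF]
  exact hν _ _ _

theorem IsomorphicProd.isNovikovProd {μ : V →ₗ[k] V →ₗ[k] V} {ν : W →ₗ[k] W →ₗ[k] W}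
    (h : IsomorphicProd μ ν) (hν : IsNovikovProd ν) : IsNovikovProd μ := by
  obtain ⟨F, hF⟩ := h
  refine fun x y => LinearMap.ext fun z => F.injective ?_
  have := LinearMap.congr_fun (hν (F x) (F y)) (F z)
  simpa [rightMul, hF] using this

theorem IsomorphicProd.isTransitiveProd {μ : V →ₗ[k] V →ₗ[k] V} {ν : W →ₗ[k] W →ₗ[k] W}
    (h : IsomorphicProd μ ν) (hν : IsTransitiveProd ν) : IsTransitiveProd μ := by
  obtain ⟨F, hF⟩ := h
  intro x
  obtain ⟨n, hn⟩ := hν (F x)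
  have key : ∀ (m : ℕ) (y : V), F ((rightMul μ x ^ m) y) = (rightMul ν (F x) ^ m) (F y) := by
    intro m
    induction m with
    | zero => simp
    | succ m ih =>
      intro y
      rw [pow_succ, pow_succ, Module.End.mul_apply, Module.End.mul_apply, ih]
      simp [rightMul, hF]
  exact ⟨n, LinearMap.ext fun y => F.injective (by rw [key, hn]; simp)⟩

theorem IsAssociativeProd.isBisymmetricProd {μ : V →ₗ[k] V →ₗ[k] V} (h : IsAssociativeProd μ) :
    IsBisymmetricProd μ := fun x y z => by simp [prodAssociator, h _ _ _]

/-- The associator as a trilinear map. -/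
def associatorMap (μ : V →ₗ[k] V →ₗ[k] V) : V →ₗ[k] V →ₗ[k] V →ₗ[k] V :=
  μ.compr₂ μ - (LinearMap.llcomp k V V V ∘ₗ μ).compl₂ μ

@[simp] theorem associatorMap_apply (μ : V →ₗ[k] V →ₗ[k] V) (x y z : V) :
    associatorMap μ x y z = prodAssociator μ x y z := by
  simp [associatorMap, prodAssociator]

variable {ι : Type*} (b : Module.Basis ι k V)

include b in
theorem isLeftSymmetric_iff_basis {μ : V →ₗ[k] V →ₗ[k] V} :
    IsLeftSymmetric μ ↔ ∀ i j l,
      prodAssociator μ (b i) (b j) (b l) = prodAssociator μ (b j) (b i) (b l) := by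
  refine ⟨fun h i j l => h _ _ _, fun h x y z => ?_⟩
  have : associatorMap μ = (associatorMap μ).flip :=
    b.ext fun i => b.ext fun j => b.ext fun l => by simp [h i j l]
  simpa using LinearMap.congr_fun (LinearMap.congr_fun (LinearMap.congr_fun this x) y) z

include b in
theorem isBisymmetric_iff_basis {μ : V →ₗ[k] V →ₗ[k] V} :
    IsBisymmetricProd μ ↔ ∀ i j l,
      prodAssociator μ (b i) (b j) (b l) = prodAssociator μ (b i) (b l) (b j) := by
  refine ⟨fun h i j l => h _ _ _, fun h x y z => ?_⟩
  have : associatorMap μ = 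
      (LinearMap.lflip : (V →ₗ[k] V →ₗ[k] V) ≃ₗ[k] V →ₗ[k] V →ₗ[k] V).toLinearMap ∘ₗ
        associatorMap μ :=
    b.ext fun i => b.ext fun j => b.ext fun l => by simp [h i j l]
  simpa using LinearMap.congr_fun (LinearMap.congr_fun (LinearMap.congr_fun this x) y) z

include b in
theorem isAssociative_iff_basis {μ : V →ₗ[k] V →ₗ[k] V} :
    IsAssociativeProd μ ↔ ∀ i j l, prodAssociator μ (b i) (b j) (b l) = 0 := by
  refine ⟨fun h i j l => sub_eq_zero.2 (h _ _ _), fun h x y z => sub_eq_zero.1 ?_⟩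
  have : associatorMap μ = 0 := b.ext fun i => b.ext fun j => b.ext fun l => by simp [h i j l]
  exact (associatorMap_apply μ x y z).symm.trans
    (LinearMap.congr_fun (LinearMap.congr_fun (LinearMap.congr_fun this x) y) z)

include b in
theorem isNovikov_iff_basis {μ : V →ₗ[k] V →ₗ[k] V} :
    IsNovikovProd μ ↔ ∀ i j,
      rightMul μ (b i) * rightMul μ (b j) = rightMul μ (b j) * rightMul μ (b i) := by
  refine ⟨fun h i j => h _ _, fun h x y => ?_⟩
  have : (LinearMap.mul k (Module.End k V)).compl₁₂ μ.flip μ.flip =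
      ((LinearMap.mul k (Module.End k V)).compl₁₂ μ.flip μ.flip).flip :=
    b.ext fun i => b.ext fun j => h i j
  exact LinearMap.congr_fun (LinearMap.congr_fun this x) y

end Transport

/-! ### Structure constants on `LieN` and the properties of the named algebras -/

namespace LieN

/-- The basis `e₁, e₂, e₃`. -/
noncomputable def basis : Module.Basis (Fin 3) ℂ LieN := .ofEquivFun coord

@[simp] theorem coord_basis (i : Fin 3) : coord (basis i) = Pi.single i 1 := by
  simp [basis]

theorem basis_zero : basis 0 = e₁ := by
  apply coord.injective; rw [coord_basis, coord_e₁]; ext i; fin_cases i <;> rfl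

theorem basis_one : basis 1 = e₂ := by
  apply coord.injective; rw [coord_basis, coord_e₂]; ext i; fin_cases i <;> rfl

theorem basis_two : basis 2 = e₃ := by
  apply coord.injective; rw [coord_basis, coord_e₃]; ext i; fin_cases i <;> rfl

theorem eq_sum_coord (x : LieN) : x = coord x 0 • e₁ + coord x 1 • e₂ + coord x 2 • e₃ := by
  have := basis.sum_repr x
  rw [Fin.sum_univ_three, basis_zero, basis_one, basis_two] at this
  exact this.symm

theorem ofMatrix_apply (M : Matrix (Fin 3) (Fin 3) LieN) (x y : LieN) :
    ofMatrix M x y = ∑ i, ∑ j, (coord x i * coord y j) • M i j := rfl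

@[simp] theorem ofMatrix_basis (M : Matrix (Fin 3) (Fin 3) LieN) (i j : Fin 3) :
    ofMatrix M (basis i) (basis j) = M i j := by
  simp [ofMatrix_apply, Pi.single_apply]

theorem coord_prod (μ : LieN →ₗ[ℂ] LieN →ₗ[ℂ] LieN) (x y : LieN) (l : Fin 3) :
    coord (μ x y) l = ∑ i, ∑ j, coord x i * coord y j * coord (μ (basis i) (basis j)) l := by
  conv_lhs => rw [← basis.sum_repr x, ← basis.sum_repr y]
  simp [basis, Finset.mul_sum, mul_assoc]
  rw [Finset.sum_comm]
  exact Finset.sum_congr rfl fun i _ => Finset.sum_congr rfl fun j _ => mul_left_comm _ _ _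

/-- The coordinates of the associators of basis vectors in terms of structure constants. -/
theorem coord_associator (M : Matrix (Fin 3) (Fin 3) LieN) (i j k l : Fin 3) :
    coord (prodAssociator (ofMatrix M) (basis i) (basis j) (basis k)) l =
      ∑ m, (coord (M i j) m * coord (M m k) l - coord (M j k) m * coord (M i m) l) := by
  simp only [prodAssociator, ofMatrix_basis, map_sub, Pi.sub_apply]
  rw [coord_prod, coord_prod (ofMatrix M) (basis i)]
  simp [Pi.single_apply, Finset.sum_sub_distrib]

theorem isLeftSymmetric_ofMatrix {M : Matrix (Fin 3) (Fin 3) LieN}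
    (h : ∀ k l, ∑ m, (coord (M 0 1) m * coord (M m k) l - coord (M 1 k) m * coord (M 0 m) l) =
        ∑ m, (coord (M 1 0) m * coord (M m k) l - coord (M 0 k) m * coord (M 1 m) l) ∧
      ∑ m, (coord (M 0 2) m * coord (M m k) l - coord (M 2 k) m * coord (M 0 m) l) =
        ∑ m, (coord (M 2 0) m * coord (M m k) l - coord (M 0 k) m * coord (M 2 m) l) ∧
      ∑ m, (coord (M 1 2) m * coord (M m k) l - coord (M 2 k) m * coord (M 1 m) l) =
        ∑ m, (coord (M 2 1) m * coord (M m k) l - coord (M 1 k) m * coord (M 2 m) l)) :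
    IsLeftSymmetric (ofMatrix M) := by
  rw [isLeftSymmetric_iff_basis basis]
  intro i j k
  ext l
  rw [coord_associator, coord_associator]
  obtain ⟨h₁, h₂, h₃⟩ := h k l
  fin_cases i <;> fin_cases j
  exacts [rfl, h₁, h₂, h₁.symm, rfl, h₃, h₂.symm, h₃.symm, rfl]

theorem isLeftSymmetricOn_ofMatrix {M : Matrix (Fin 3) (Fin 3) LieN}
    (h : IsLeftSymmetric (ofMatrix M)) (h₀₁ : M 0 1 = M 1 0) (h₀₂ : M 0 2 = M 2 0)
    (h₁₂ : M 2 1 = M 1 2 + e₂) : IsLeftSymmetricOn (ofMatrix M) := by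
  refine ⟨h, fun x y => ?_⟩
  simp only [ofMatrix_apply, Fin.sum_univ_three, bracket_def, h₀₁, h₀₂, h₁₂]
  module

end LieN

open LieN

set_option maxHeartbeats 4000000 in
theorem NName.isLeftSymmetricOn (c : NName) (hc : c.Admissible) :
    IsLeftSymmetricOn c.product := by
  refine isLeftSymmetricOn_ofMatrix (isLeftSymmetric_ofMatrix ?_) ?_ ?_ ?_
  · cases c <;> simp [charMatrix, Fin.forall_fin_succ, Fin.sum_univ_three, Admissible] at hc ⊢ <;> grind
  all_goals cases c <;> simp [charMatrix, add_smul, add_comm, two_smul, neg_smul, add_sub_assoc]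

namespace LieN

set_option maxHeartbeats 4000000 in
theorem isBisymmetricProd_ofMatrix_iff {M : Matrix (Fin 3) (Fin 3) LieN} :
    IsBisymmetricProd (ofMatrix M) ↔ ∀ i l,
      ∑ m, (coord (M i 0) m * coord (M m 1) l - coord (M 0 1) m * coord (M i m) l) =
        ∑ m, (coord (M i 1) m * coord (M m 0) l - coord (M 1 0) m * coord (M i m) l) ∧
      ∑ m, (coord (M i 0) m * coord (M m 2) l - coord (M 0 2) m * coord (M i m) l) =
        ∑ m, (coord (M i 2) m * coord (M m 0) l - coord (M 2 0) m * coord (M i m) l) ∧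
      ∑ m, (coord (M i 1) m * coord (M m 2) l - coord (M 1 2) m * coord (M i m) l) =
        ∑ m, (coord (M i 2) m * coord (M m 1) l - coord (M 2 1) m * coord (M i m) l) := by
  simp only [← coord_associator]
  refine ⟨fun h i l => ⟨by rw [h], by rw [h], by rw [h]⟩, fun h => ?_⟩
  rw [isBisymmetric_iff_basis basis]
  intro i j k
  ext l
  obtain ⟨h₁, h₂, h₃⟩ := h i l
  fin_cases j <;> fin_cases k
  exacts [rfl, h₁, h₂, h₁.symm, rfl, h₃, h₂.symm, h₃.symm, rfl]

theorem coord_rightMul_mul (M : Matrix (Fin 3) (Fin 3) LieN) (i j k l : Fin 3) :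
    coord ((rightMul (ofMatrix M) (basis j) * rightMul (ofMatrix M) (basis i)) (basis k)) l =
      ∑ m, coord (M k i) m * coord (M m j) l := by
  simp only [rightMul, Module.End.mul_apply, LinearMap.flip_apply, ofMatrix_basis]
  rw [coord_prod]
  simp [Pi.single_apply]

set_option maxHeartbeats 4000000 in
theorem isNovikovProd_ofMatrix_iff {M : Matrix (Fin 3) (Fin 3) LieN} :
    IsNovikovProd (ofMatrix M) ↔ ∀ k l,
      ∑ m, coord (M k 0) m * coord (M m 1) l = ∑ m, coord (M k 1) m * coord (M m 0) l ∧
      ∑ m, coord (M k 0) m * coord (M m 2) l = ∑ m, coord (M k 2) m * coord (M m 0) l ∧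
      ∑ m, coord (M k 1) m * coord (M m 2) l = ∑ m, coord (M k 2) m * coord (M m 1) l := by
  simp only [← coord_rightMul_mul]
  refine ⟨fun h i l => ⟨by rw [h], by rw [h], by rw [h]⟩, fun h => ?_⟩
  rw [isNovikov_iff_basis basis]
  refine fun i j => basis.ext fun k => ?_
  ext l
  obtain ⟨h₁, h₂, h₃⟩ := h k l
  fin_cases i <;> fin_cases j
  exacts [rfl, h₁.symm, h₂.symm, h₁, rfl, h₃.symm, h₂, h₃, rfl]

set_option maxHeartbeats 4000000 in
theorem isAssociativeProd_ofMatrix_iff {M : Matrix (Fin 3) (Fin 3) LieN} :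
    IsAssociativeProd (ofMatrix M) ↔ ∀ i j k l,
      ∑ m, (coord (M i j) m * coord (M m k) l - coord (M j k) m * coord (M i m) l) = 0 := by
  simp only [← coord_associator]
  rw [isAssociative_iff_basis basis]
  refine forall₃_congr fun i j k => ⟨fun h l => by simp [h], fun h => ext fun l => by simp [h]⟩

theorem trace_eq (f : Module.End ℂ LieN) :
    LinearMap.trace ℂ LieN f = coord (f e₁) 0 + coord (f e₂) 1 + coord (f e₃) 2 := by
  rw [LinearMap.trace_eq_matrix_trace ℂ basis, Matrix.trace, Fin.sum_univ_three, ← basis_zero,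
    ← basis_one, ← basis_two]
  simp [LinearMap.toMatrix_apply, basis]

end LieN

namespace NName

set_option maxHeartbeats 4000000 in
theorem isBisymmetricProd_iff (c : NName) (hc : c.Admissible) :
    IsBisymmetricProd c.product ↔ c ∈ bisymmetricList := by
  unfold product
  rw [isBisymmetricProd_ofMatrix_iff]
  cases c <;> simp [charMatrix, Fin.forall_fin_succ, Fin.sum_univ_three, Admissible,
    bisymmetricList] at hc ⊢ <;> grind
set_option maxHeartbeats 4000000 in
theorem isNovikovProd_iff (c : NName) (hc : c.Admissible) :
    IsNovikovProd c.product ↔ c ∈ novikovList := by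
  unfold product
  rw [isNovikovProd_ofMatrix_iff]
  cases c <;> simp [charMatrix, Fin.forall_fin_succ, Fin.sum_univ_three, Admissible,
    novikovList] at hc ⊢ <;> grind

set_option maxHeartbeats 4000000 in
theorem isAssociativeProd_iff (c : NName) (hc : c.Admissible) :
    IsAssociativeProd c.product ↔ c ∈ associativeList := by
  -- Associativity implies bi-symmetry, so only the fourteen bi-symmetric families have to be
  -- tested.
  have key : c ∈ bisymmetricList → (IsAssociativeProd c.product ↔ c ∈ associativeList) := by
    unfold product
    rw [isAssociativeProd_ofMatrix_iff]
    rintro (rfl | rfl | rfl | rfl | rfl | rfl | rfl | rfl | rfl | rfl | rfl | rfl | rfl | rfl) <;>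
      simp [charMatrix, Fin.forall_fin_succ, Fin.sum_univ_three, associativeList]
  refine ⟨fun h => (key ?_).1 h, fun h => (key ?_).2 h⟩
  · exact (isBisymmetricProd_iff c hc).1 h.isBisymmetricProd
  · simp only [associativeList, bisymmetricList, Set.mem_insert_iff, Set.mem_singleton_iff] at h ⊢
    tauto

set_option maxHeartbeats 4000000 in
theorem isTransitiveProd_iff (c : NName) (hc : c.Admissible) :
    IsTransitiveProd c.product ↔ c ∈ transitiveList := by
  constructor
  · intro h
    -- The traces of `R_{e₁}` and `R_{e₃}` already exclude every unlisted algebra; for the listed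
    -- ones `R_x ^ 3 = 0`.
    have tr : ∀ x, LinearMap.trace ℂ LieN (rightMul c.product x) = 0 := fun x =>
      (LinearMap.isNilpotent_trace_of_isNilpotent (h x)).eq_zero
    have h₁ := tr (basis 0)
    have h₃ := tr (basis 2)
    simp only [trace_eq, rightMul, product, LinearMap.flip_apply, ← basis_zero, ← basis_one,
      ← basis_two, ofMatrix_basis] at h₁ h₃
    cases c <;> simp [charMatrix, transitiveList, Admissible] at hc h₁ h₃ ⊢ <;> grind
  · rintro (rfl | rfl | rfl) <;> refine fun x => ⟨3, LinearMap.ext fun y => LieN.ext fun i => ?_⟩ <;>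
    simp only [pow_succ, pow_zero, one_mul, Module.End.mul_apply, rightMul, product,
      LinearMap.flip_apply, ofMatrix_apply, Fin.sum_univ_three] <;>
    fin_cases i <;> simp [charMatrix]

end NName

/-! ### Automorphisms of the Lie algebra and normal forms of split tables -/

namespace LieN

/-- The Lie algebra automorphism `e₁ ↦ d e₁`, `e₂ ↦ a e₂`, `e₃ ↦ e₃ + b e₂ + c e₁`. -/
noncomputable def frameChange (a b c d : ℂ) (ha : a ≠ 0) (hd : d ≠ 0) : LieN ≃ₗ[ℂ] LieN where
  toFun x := (d * coord x 0 + c * coord x 2) • e₁ + (a * coord x 1 + b * coord x 2) • e₂ +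
    coord x 2 • e₃
  invFun x := ((coord x 0 - c * coord x 2) / d) • e₁ + ((coord x 1 - b * coord x 2) / a) • e₂ +
    coord x 2 • e₃
  map_add' x y := by simp only [map_add, Pi.add_apply]; module
  map_smul' r x := by simp only [map_smul, Pi.smul_apply, smul_eq_mul, RingHom.id_apply]; module
  left_inv x := by
    ext i; fin_cases i <;> simp [hd, ha]
  right_inv x := by
    ext i; fin_cases i <;> simp [mul_div_cancel₀, hd, ha]

theorem isomorphicProd_of_frame {M M' : Matrix (Fin 3) (Fin 3) LieN} (a b c d : ℂ) (ha : a ≠ 0)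
    (hd : d ≠ 0) (h : ∀ i j, frameChange a b c d ha hd (M' i j) =
      ofMatrix M (frameChange a b c d ha hd (basis i)) (frameChange a b c d ha hd (basis j))) :
    IsomorphicProd (ofMatrix M) (ofMatrix M') := by
  set G := frameChange a b c d ha hd
  have : (ofMatrix M').compr₂ G.toLinearMap = (ofMatrix M).compl₁₂ G.toLinearMap G.toLinearMap :=
    basis.ext fun i => basis.ext fun j => by simpa using h i j
  refine ⟨G.symm, fun x y => ?_⟩
  rw [LinearEquiv.symm_apply_eq]
  simpa using (LinearMap.congr_fun (LinearMap.congr_fun this (G.symm x)) (G.symm y)).symm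

/-- The product tables to which the Novikov and the non-unital bi-symmetric cases reduce. -/
noncomputable def splitTable (s p l κ w₁ w₂ : ℂ) : Matrix (Fin 3) (Fin 3) LieN :=
  !![s • e₁, 0, p • e₁; 0, 0, l • e₂; p • e₁, (l + 1) • e₂, w₁ • e₁ + w₂ • e₂ + κ • e₃]

/-- The `e₁` and `e₂` components of `e₃e₃` transform independently: `c` and `d` act on the first,
`a` and `b` on the second. Subtracting `κ` times the new `e₃` produces the terms `-κc` and `-κb`. -/
theorem splitTable_isomorphic {s p l κ w₁ w₂ : ℂ} (a b c d : ℂ) (ha : a ≠ 0) (hd : d ≠ 0)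
    {s' p' w₁' w₂' : ℂ} (hs : s' = s * d) (hp : p' = p + c * s)
    (h₁ : d * w₁' = w₁ + 2 * c * p + c ^ 2 * s - κ * c)
    (h₂ : a * w₂' = w₂ + b * (2 * l + 1 - κ)) :
    IsomorphicProd (ofMatrix (splitTable s p l κ w₁ w₂))
      (ofMatrix (splitTable s' p' l κ w₁' w₂')) := by
  subst hs hp
  refine isomorphicProd_of_frame a b c d ha hd fun i j => ext fun k => ?_
  rw [ofMatrix_apply, Fin.sum_univ_three, Fin.sum_univ_three, Fin.sum_univ_three, Fin.sum_univ_three]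
  fin_cases i <;> fin_cases j <;> fin_cases k <;>
    simp [frameChange, splitTable] <;> grind

/-- The hypothesis is the relation `e₁(e₃e₃) = e₃(e₁e₃)`, part of left-symmetry. The entry `w₂` can
be translated away unless `κ = 2l + 1`; in that resonant case it can only be rescaled to `1`.
Similarly `w₁` survives only when `s = p = κ = 0`. -/
theorem splitTable_normalForm {s p l κ w₁ w₂ : ℂ} (h : s * w₁ = p * (p - κ)) :
    ∃ s' p' w₁' w₂', IsomorphicProd (ofMatrix (splitTable s p l κ w₁ w₂))
        (ofMatrix (splitTable s' p' l κ w₁' w₂')) ∧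
      (s' = 1 ∧ p' = 0 ∧ w₁' = 0 ∨ s' = 0 ∧ p' = κ ∧ κ ≠ 0 ∧ w₁' = 0 ∨
        s' = 0 ∧ p' = 0 ∧ (w₁' = 0 ∨ κ = 0 ∧ w₁' = 1)) ∧
      (w₂' = 0 ∨ w₂' = 1 ∧ κ = 2 * l + 1) := by
  obtain ⟨a, b, w₂', ha, hw₂, h₂⟩ : ∃ a b w₂', a ≠ 0 ∧ (w₂' = 0 ∨ w₂' = 1 ∧ κ = 2 * l + 1) ∧
      a * w₂' = w₂ + b * (2 * l + 1 - κ) := by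
    by_cases hκ : κ = 2 * l + 1
    · by_cases hw : w₂ = 0
      · exact ⟨1, 0, 0, one_ne_zero, .inl rfl, by simp [hw]⟩
      · exact ⟨w₂, 0, 1, hw, .inr ⟨rfl, hκ⟩, by simp⟩
    · have : 2 * l + 1 - κ ≠ 0 := fun h => hκ (sub_eq_zero.1 h).symm
      exact ⟨1, -w₂ / (2 * l + 1 - κ), 0, one_ne_zero, .inl rfl, by field_simp; ring⟩
  by_cases hs : s = 0
  · subst hs
    by_cases hp : p = 0
    · subst hp
      by_cases hκ : κ = 0
      · by_cases hw : w₁ = 0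
        · exact ⟨_, _, 0, w₂', splitTable_isomorphic a b 0 1 ha one_ne_zero rfl rfl
            (by simp [hw]) h₂, by simp, hw₂⟩
        · exact ⟨_, _, 1, w₂', splitTable_isomorphic a b 0 w₁ ha hw rfl rfl
            (by simp) h₂, by simp [hκ], hw₂⟩
      · exact ⟨_, _, 0, w₂', splitTable_isomorphic a b (w₁ / κ) 1 ha one_ne_zero rfl rfl
            (by field_simp; ring) h₂, by simp, hw₂⟩
    · obtain rfl : p = κ := by grind
      exact ⟨_, _, 0, w₂', splitTable_isomorphic a b (-w₁ / p) 1 ha one_ne_zero rfl rfl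
            (by field_simp; ring) h₂, by simp [hp], hw₂⟩
  -- The shift `c = -p / s` makes `e₁e₃` vanish, and `d = 1 / s` makes `e₁` idempotent; the
  -- hypothesis then kills `w₁` as well.
  · refine ⟨_, _, 0, w₂', splitTable_isomorphic a b (-p / s) (1 / s) ha (by simp [hs]) rfl rfl
            (by field_simp; linear_combination -h) h₂, .inl ?_, hw₂⟩
    simp [hs]

end LieN

namespace LieN

theorem eq_iff_coord {x y : LieN} :
    x = y ↔ coord x 0 = coord y 0 ∧ coord x 1 = coord y 1 ∧ coord x 2 = coord y 2 := by
  refine ⟨fun h => by simp [h], fun ⟨h₀, h₁, h₂⟩ => ext fun i => ?_⟩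
  fin_cases i
  exacts [h₀, h₁, h₂]

theorem bracket_e₃_e₂ : ⁅e₃, e₂⁆ = e₂ := by simp [bracket_def]

theorem e₁_bracket (x : LieN) : ⁅e₁, x⁆ = 0 := by simp [bracket_def]

/-- A product on `N` is given by its values on pairs of basis vectors. -/
theorem eq_ofMatrix (μ : LieN →ₗ[ℂ] LieN →ₗ[ℂ] LieN) :
    μ = ofMatrix !![μ e₁ e₁, μ e₁ e₂, μ e₁ e₃; μ e₂ e₁, μ e₂ e₂, μ e₂ e₃;
      μ e₃ e₁, μ e₃ e₂, μ e₃ e₃] := by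
  refine basis.ext fun i => basis.ext fun j => ?_
  rw [ofMatrix_basis]
  fin_cases i <;> fin_cases j <;> simp [← basis_zero, ← basis_one, ← basis_two]

end LieN

/-! ### Left multiplications as a representation, and the central element `e₁` -/

namespace IsLeftSymmetricOn

section General

variable {k G : Type*} [Field k] [LieRing G] [LieAlgebra k G] {μ : G →ₗ[k] G →ₗ[k] G}

/-- Left multiplication is a representation of the Lie algebra. -/
theorem leftMul_lie (h : IsLeftSymmetricOn μ) (x y : G) :
    (μ ⁅x, y⁆ : Module.End k G) = (μ x : Module.End k G) * μ y - μ y * μ x := by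
  ext z
  have := h.1 x y z
  simp only [prodAssociator] at this
  rw [← h.2]
  simp only [map_sub, LinearMap.sub_apply, Module.End.mul_apply]
  linear_combination (norm := module) this

theorem trace_leftMul_lie (h : IsLeftSymmetricOn μ) (x y : G) :
    LinearMap.trace k G (μ ⁅x, y⁆) = 0 := by
  rw [h.leftMul_lie, map_sub, LinearMap.trace_mul_comm, sub_self]

theorem eq_add_lie (h : IsLeftSymmetricOn μ) (x y : G) : μ x y = μ y x + ⁅x, y⁆ := by
  rw [← h.2, add_sub_cancel]

end General

variable {μ : LieN →ₗ[ℂ] LieN →ₗ[ℂ] LieN}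

theorem apply_e₁ (h : IsLeftSymmetricOn μ) (x : LieN) : μ x e₁ = μ e₁ x := by
  have := h.eq_add_lie e₁ x
  rw [e₁_bracket, add_zero] at this
  exact this.symm

theorem apply_e₃_e₂ (h : IsLeftSymmetricOn μ) : μ e₃ e₂ = μ e₂ e₃ + e₂ := by
  rw [h.eq_add_lie, bracket_e₃_e₂]

/-- The left multiplication by the central element `e₁` commutes with all left multiplications. -/
theorem leftMul_e₁_comm (h : IsLeftSymmetricOn μ) (x y : LieN) :
    μ e₁ (μ x y) = μ x (μ e₁ y) := by
  have := LinearMap.congr_fun (h.leftMul_lie e₁ x) y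
  rw [e₁_bracket, map_zero] at this
  exact sub_eq_zero.1 (by simpa using this.symm)

theorem trace_leftMul_e₂ (h : IsLeftSymmetricOn μ) : LinearMap.trace ℂ LieN (μ e₂) = 0 := by
  have := h.trace_leftMul_lie e₃ e₂
  rwa [bracket_e₃_e₂] at this

/-- If the left multiplication by `e₁` lies in the centroid, it is nearly diagonal. -/
theorem leftMul_e₁_of_centroid (h : IsLeftSymmetricOn μ)
    (hT : ∀ x y, μ (μ e₁ x) y = μ e₁ (μ x y)) :
    ∃ s t p : ℂ, μ e₁ e₁ = s • e₁ ∧ μ e₁ e₂ = t • e₂ ∧ μ e₁ e₃ = p • e₁ + t • e₃ ∧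
      t * t = s * t ∧ t * p = 0 := by
  -- A centroid element commutes with left and right multiplications, hence with their difference,
  -- the adjoint action.
  have lie : ∀ x y, ⁅μ e₁ x, y⁆ = μ e₁ ⁅x, y⁆ := fun x y => by
    rw [← h.2, ← h.2, hT, ← h.leftMul_e₁_comm, map_sub]
  have h₁ := lie e₁ e₂
  have h₁' := lie e₁ e₃
  have h₂ := lie e₂ e₃
  have h₃ := lie e₃ e₂
  have h₃' := lie e₃ e₃
  -- Evaluating `(e₁e₁)e₃ = e₁(e₁e₃)` gives the two quadratic relations on `s`, `t`, `p`.
  have hss := hT e₁ e₃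
  rw [bracket_e₃_e₂] at h₃
  rw [lie_self, map_zero] at h₃'
  rw [e₁_bracket, map_zero] at h₁ h₁'
  rw [← lie_skew e₂ e₃, bracket_e₃_e₂, map_neg] at h₂
  generalize hx : μ e₁ e₁ = x at *
  generalize hy : μ e₁ e₂ = y at *
  generalize hz : μ e₁ e₃ = z at *
  simp only [bracket_def, eq_iff_coord] at h₁ h₁' h₂ h₃ h₃'
  simp at h₁ h₁' h₂ h₃ h₃'
  refine ⟨coord x 0, coord y 1, coord z 0, ?_, ?_, ?_, ?_⟩
  · rw [eq_iff_coord]; simp; grind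
  · rw [eq_iff_coord]; simp; grind
  · rw [eq_iff_coord]; simp; grind
  · rw [eq_sum_coord x, eq_sum_coord z] at hss
    simp [hx, hy, hz, eq_iff_coord] at hss
    grind

end IsLeftSymmetricOn

namespace LieN

theorem exists_coords (x : LieN) : ∃ a b c : ℂ, x = a • e₁ + b • e₂ + c • e₃ :=
  ⟨_, _, _, eq_sum_coord x⟩

/-- The product tables to which the unital bi-symmetric case reduces. -/
noncomputable def unitalTable (t l w₁ w₂ : ℂ) : Matrix (Fin 3) (Fin 3) LieN :=
  !![t • e₁, t • e₂, t • e₃; t • e₂, 0, l • e₂;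
    t • e₃, (l + 1) • e₂, w₁ • e₁ + w₂ • e₂ + (2 * l + 1) • e₃]

end LieN

/-! ### Tables forced by the Novikov and bi-symmetric identities -/

namespace IsLeftSymmetricOn

variable {μ : LieN →ₗ[ℂ] LieN →ₗ[ℂ] LieN}

theorem eq_splitTable_of_novikov (h : IsLeftSymmetricOn μ) (hN : IsNovikovProd μ) :
    ∃ s p l w₁ w₂ : ℂ, μ = ofMatrix (splitTable s p l l w₁ w₂) ∧ s * w₁ = p * (p - l) := by
  have hR : ∀ x y z, μ (μ z y) x = μ (μ z x) y := fun x y z =>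
    LinearMap.congr_fun (hN x y) z
  -- Left multiplication by the central `e₁` is also `R_{e₁}`, which commutes with all `R_y`.
  have hT : ∀ x y, μ (μ e₁ x) y = μ e₁ (μ x y) := fun x y => by
    rw [← h.apply_e₁, ← h.apply_e₁, hR]
  obtain ⟨s, t, p, h₁₁, h₁₂, h₁₃, ht, htp⟩ := h.leftMul_e₁_of_centroid hT
  obtain ⟨u₁, u₂, u₃, hu⟩ := exists_coords (μ e₂ e₂)
  obtain ⟨v₁, v₂, v₃, hv⟩ := exists_coords (μ e₂ e₃)
  obtain ⟨w₁, w₂, w₃, hw⟩ := exists_coords (μ e₃ e₃)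
  have h₂₁ := h.apply_e₁ e₂
  have h₃₁ := h.apply_e₁ e₃
  have h₃₂ := h.apply_e₃_e₂
  rw [h₁₂] at h₂₁
  rw [h₁₃] at h₃₁
  rw [hv] at h₃₂
  have tr := h.trace_leftMul_e₂
  have A := h.1 e₃ e₂ e₂
  have B := h.1 e₃ e₂ e₃
  have C := hR e₂ e₃ e₂
  have D := hR e₂ e₃ e₃
  have E := hR e₂ e₃ e₁
  have F := hT e₃ e₃
  have G := hT e₂ e₃
  simp [prodAssociator, trace_eq, h₁₁, h₁₂, h₁₃, h₂₁, hu, hv, h₃₁, h₃₂, hw, eq_iff_coord]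
    at tr A B C D E F G
  obtain rfl : t = 0 := by grind
  obtain rfl : u₂ = 0 := by grind
  obtain rfl : v₃ = 0 := by grind
  obtain rfl : u₁ = 0 := by grind
  obtain rfl : u₃ = 0 := by grind
  obtain rfl : v₁ = 0 := by grind
  obtain rfl : w₃ = v₂ := by grind
  refine ⟨s, p, w₃, w₁, w₂, ?_, by grind⟩
  rw [eq_ofMatrix μ, splitTable, h₁₁, h₁₂, h₁₃, h₂₁, hu, hv, h₃₁, h₃₂, hw]
  simp [add_smul]

theorem eq_table_of_bisymmetric (h : IsLeftSymmetricOn μ) (hB : IsBisymmetricProd μ) :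
    (∃ s p l w₁ w₂ : ℂ, μ = ofMatrix (splitTable s p l (2 * l + 1) w₁ w₂) ∧ (l = 0 ∨ l = -1) ∧
      s * w₁ = p * (p - (2 * l + 1))) ∨
    ∃ t l w₁ w₂ : ℂ, μ = ofMatrix (unitalTable t l w₁ w₂) ∧ t ≠ 0 ∧ w₁ * t = -(l * (l + 1)) := by
  -- The associator `(x, y, e₁)` vanishes because `L_{e₁} = R_{e₁}` commutes with `L_x`; by
  -- bi-symmetry so does `(x, e₁, y)`.
  have hT : ∀ x y, μ (μ e₁ x) y = μ e₁ (μ x y) := fun x y => by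
    have := hB x e₁ y
    simp only [prodAssociator, h.apply_e₁, h.leftMul_e₁_comm] at this
    rw [sub_self, sub_eq_zero] at this
    rw [this, h.leftMul_e₁_comm]
  obtain ⟨s, t, p, h₁₁, h₁₂, h₁₃, ht, htp⟩ := h.leftMul_e₁_of_centroid hT
  obtain ⟨u₁, u₂, u₃, hu⟩ := exists_coords (μ e₂ e₂)
  obtain ⟨v₁, v₂, v₃, hv⟩ := exists_coords (μ e₂ e₃)
  obtain ⟨w₁, w₂, w₃, hw⟩ := exists_coords (μ e₃ e₃)
  have h₂₁ := h.apply_e₁ e₂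
  have h₃₁ := h.apply_e₁ e₃
  have h₃₂ := h.apply_e₃_e₂
  rw [h₁₂] at h₂₁
  rw [h₁₃] at h₃₁
  rw [hv] at h₃₂
  have tr := h.trace_leftMul_e₂
  have A := h.1 e₃ e₂ e₂
  have B := h.1 e₃ e₂ e₃
  have C := hB e₂ e₂ e₃
  have D := hB e₃ e₂ e₃
  have F := hT e₃ e₃
  simp [prodAssociator, trace_eq, h₁₁, h₁₂, h₁₃, h₂₁, hu, hv, h₃₁, h₃₂, hw, eq_iff_coord]
    at tr A B C D F
  obtain rfl : u₂ = 0 := by grind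
  obtain rfl : v₃ = 0 := by grind
  obtain rfl : u₁ = 0 := by grind
  obtain rfl : u₃ = 0 := by grind
  obtain rfl : v₁ = 0 := by grind
  obtain rfl : w₃ = 2 * v₂ + 1 := by grind
  -- If `t ≠ 0`, then `s = t` and `p = 0`, so `e₁ / t` is an identity element.
  by_cases ht₀ : t = 0
  · subst ht₀
    refine .inl ⟨s, p, v₂, w₁, w₂, ?_, by grind, by grind⟩
    rw [eq_ofMatrix μ, splitTable, h₁₁, h₁₂, h₁₃, h₂₁, hu, hv, h₃₁, h₃₂, hw]
    simp [add_smul]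
  · obtain rfl : s = t := by grind
    obtain rfl : p = 0 := by grind
    refine .inr ⟨s, v₂, w₁, w₂, ?_, ht₀, by grind⟩
    rw [eq_ofMatrix μ, unitalTable, h₁₁, h₁₂, h₁₃, h₂₁, hu, hv, h₃₁, h₃₂, hw]
    simp [add_smul]

end IsLeftSymmetricOn

namespace LieN

/-- Since `e₁ / t` is the identity, replacing `e₃` by `e₃ - (l / t)e₁` lowers `l` to `0`; the
relation on `w₁` says exactly that the `e₁` component of `e₃e₃` then disappears. -/
theorem unitalTable_isomorphic {t l w₁ w₂ w₂' a : ℂ} (ht : t ≠ 0) (ha : a ≠ 0)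
    (h : w₁ * t = -(l * (l + 1))) (h₂ : a * w₂' = w₂) :
    IsomorphicProd (ofMatrix (unitalTable t l w₁ w₂)) (ofMatrix (unitalTable 1 0 0 w₂')) := by
  refine isomorphicProd_of_frame a 0 (-l / t) (1 / t) ha (by simp [ht]) fun i j => ext fun k => ?_
  rw [ofMatrix_apply, Fin.sum_univ_three, Fin.sum_univ_three, Fin.sum_univ_three, Fin.sum_univ_three]
  fin_cases i <;> fin_cases j <;> fin_cases k <;>
    simp [frameChange, unitalTable] <;> grind

end LieN

/-! ### Transitive algebras through trace forms -/

namespace IsTransitiveProd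

variable {k V : Type*} [Field k] [AddCommGroup V] [Module k V] {μ : V →ₗ[k] V →ₗ[k] V}

theorem trace_rightMul (h : IsTransitiveProd μ) (x : V) :
    LinearMap.trace k V (rightMul μ x) = 0 :=
  (LinearMap.isNilpotent_trace_of_isNilpotent (h x)).eq_zero

theorem trace_rightMul_sq (h : IsTransitiveProd μ) (x : V) :
    LinearMap.trace k V (rightMul μ x * rightMul μ x) = 0 :=
  (LinearMap.isNilpotent_trace_of_isNilpotent
    ((Commute.refl (rightMul μ x)).isNilpotent_mul_left (h x))).eq_zero

/-- Polarization of the vanishing quadratic form `x ↦ tr(R_x²)`. -/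
theorem trace_rightMul_mul [NeZero (2 : k)] (h : IsTransitiveProd μ) (x y : V) :
    LinearMap.trace k V (rightMul μ x * rightMul μ y) = 0 := by
  have := h.trace_rightMul_sq (x + y)
  rw [show rightMul μ (x + y) = rightMul μ x + rightMul μ y from map_add μ.flip x y, add_mul,
    mul_add, mul_add, map_add, map_add, map_add, h.trace_rightMul_sq, h.trace_rightMul_sq,
    LinearMap.trace_mul_comm k (rightMul μ y), zero_add, add_zero, ← two_mul] at this
  exact (mul_eq_zero.1 this).resolve_left two_ne_zero

theorem eq_zero_of_rightMul_eq_smul (h : IsTransitiveProd μ) {x y : V} {c : k} (hy : y ≠ 0)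
    (hc : μ y x = c • y) : c = 0 := by
  obtain ⟨n, hn⟩ := h x
  have key : ∀ m : ℕ, (rightMul μ x ^ m) y = c ^ m • y := by
    intro m
    induction m with
    | zero => simp
    | succ m ih =>
      rw [pow_succ', Module.End.mul_apply, ih, map_smul, rightMul, LinearMap.flip_apply, hc,
        smul_smul, pow_succ]
  have := key n
  rw [hn, LinearMap.zero_apply, eq_comm, smul_eq_zero] at this
  exact pow_eq_zero_iff (n := n) (by rintro rfl; simp_all) |>.1 (this.resolve_right hy)

end IsTransitiveProd

namespace IsLeftSymmetricOn

theorem trace_leftMul_lie_mul {k G : Type*} [Field k] [LieRing G] [LieAlgebra k G]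
    {μ : G →ₗ[k] G →ₗ[k] G} (h : IsLeftSymmetricOn μ) (x y : G) :
    LinearMap.trace k G ((μ ⁅x, y⁆ : Module.End k G) * μ x) = 0 ∧
      LinearMap.trace k G ((μ ⁅x, y⁆ : Module.End k G) * μ y) = 0 := by
  rw [h.leftMul_lie]
  constructor
  · rw [sub_mul, map_sub, mul_assoc, LinearMap.trace_mul_comm k (μ x), sub_self]
  · rw [sub_mul, map_sub, mul_assoc (μ y : Module.End k G), LinearMap.trace_mul_comm k (μ y),
      mul_assoc, sub_self]

variable {μ : LieN →ₗ[ℂ] LieN →ₗ[ℂ] LieN}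

/-- `L_{e₁} = R_{e₁}` is nilpotent and commutes with `L_x`, so the product is nilpotent. -/
theorem trace_leftMul_e₁_mul (h : IsLeftSymmetricOn μ) (ht : IsTransitiveProd μ) (x : LieN) :
    LinearMap.trace ℂ LieN ((μ e₁ : Module.End ℂ LieN) * μ x) = 0 := by
  have h₁ : rightMul μ e₁ = μ e₁ := LinearMap.ext fun x => h.apply_e₁ x
  have hc : Commute (μ e₁ : Module.End ℂ LieN) (μ x) :=
    LinearMap.ext fun y => h.leftMul_e₁_comm x y
  have hn := ht e₁
  rw [h₁] at hn
  exact (LinearMap.isNilpotent_trace_of_isNilpotent (hc.isNilpotent_mul_right hn)).eq_zero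

theorem leftMul_e₂_of_transitive (h : IsLeftSymmetricOn μ) (ht : IsTransitiveProd μ) :
    μ e₂ = 0 := by
  obtain ⟨a₁, a₂, a₃, ha⟩ := exists_coords (μ e₁ e₁)
  obtain ⟨b₁, b₂, b₃, hb⟩ := exists_coords (μ e₁ e₂)
  obtain ⟨c₁, c₂, c₃, hc⟩ := exists_coords (μ e₁ e₃)
  obtain ⟨u₁, u₂, u₃, hu⟩ := exists_coords (μ e₂ e₂)
  obtain ⟨v₁, v₂, v₃, hv⟩ := exists_coords (μ e₂ e₃)
  obtain ⟨w₁, w₂, w₃, hw⟩ := exists_coords (μ e₃ e₃)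
  have hb' := h.apply_e₁ e₂
  have hc' := h.apply_e₁ e₃
  have hv' := h.apply_e₃_e₂
  rw [hb] at hb'
  rw [hc] at hc'
  rw [hv] at hv'
  have t₁ := h.trace_leftMul_e₁_mul ht e₂
  have t₂ := h.trace_leftMul_e₁_mul ht e₃
  have t₃ := (h.trace_leftMul_lie_mul e₃ e₂).1
  have t₄ := (h.trace_leftMul_lie_mul e₃ e₂).2
  rw [bracket_e₃_e₂] at t₃ t₄
  have r₁₂ := ht.trace_rightMul_mul e₁ e₂
  have r₁₃ := ht.trace_rightMul_mul e₁ e₃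
  have r₂₂ := ht.trace_rightMul_mul e₂ e₂
  have r₂₃ := ht.trace_rightMul_mul e₂ e₃
  have l₂ := h.trace_leftMul_e₂
  have r₁ := ht.trace_rightMul e₁
  have r₃ := ht.trace_rightMul e₃
  simp [rightMul, trace_eq, ha, hb, hb', hc, hc', hu, hv, hv', hw]
    at t₁ t₂ t₃ t₄ r₁₂ r₁₃ r₂₂ r₂₃ l₂ r₁ r₃
  -- As `R_x = L_x - ad x`, the quadratic terms cancel in `tr(R_xR_y) - tr(L_xL_y)`, leaving linear
  -- equations for the structure constants.
  obtain rfl : u₃ = 0 := by linear_combination (r₂₂ - t₄) / 2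
  obtain rfl : v₃ = u₂ := by linear_combination (r₂₃ - t₃)
  obtain rfl : b₃ = 0 := by linear_combination (r₁₂ - t₁)
  obtain rfl : b₂ = 0 := by linear_combination (t₂ - r₁₃)
  obtain rfl : v₃ = 0 := by grind
  obtain rfl : b₁ = 0 := by linear_combination l₂
  have A := h.leftMul_e₁_comm e₂ e₂
  have B := h.leftMul_e₁_comm e₃ e₂
  have C := h.leftMul_e₁_comm e₃ e₃
  have D := h.1 e₃ e₂ e₂
  have E := h.1 e₃ e₂ e₃
  have r₃₃ := ht.trace_rightMul_mul e₃ e₃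
  simp [prodAssociator, rightMul, trace_eq, ha, hb, hb', hc, hc', hu, hv, hv', hw, eq_iff_coord]
    at A B C D E r₁ r₃ r₃₃
  have he₁ : e₁ ≠ 0 := fun h => by simpa using congrArg (coord · 0) h
  have he₂ : e₂ ≠ 0 := fun h => by simpa using congrArg (coord · 1) h
  -- Otherwise `e₁` would be an eigenvector of the nilpotent `R_{e₃}`, so its eigenvalue `c₁` would
  -- vanish, contradicting the other relations.
  have hu₁ : u₁ = 0 := by
    by_contra hu₁
    have hc₂ : c₂ = 0 := by grind
    have hc₃ : c₃ = 0 := by grind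
    have := ht.eq_zero_of_rightMul_eq_smul (c := c₁) (x := e₃) he₁ (by simp [hc, hc₂, hc₃])
    grind
  subst hu₁
  have hv₁ : v₁ = 0 := by
    by_contra hv₁
    grind
  subst hv₁
  have hv₂ := ht.eq_zero_of_rightMul_eq_smul (c := v₂) (x := e₃) he₂ (by simp [hv])
  refine LinearMap.ext fun x => ?_
  rw [eq_sum_coord x]
  simp [hb', hu, hv, hv₂]

set_option maxHeartbeats 4000000 in
/-- Every transitive left-symmetric algebra on `N` is one of (N-1) with parameter zero, (N-5),
(N-10). -/
theorem isomorphic_of_transitive (h : IsLeftSymmetricOn μ) (ht : IsTransitiveProd μ) :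
    ∃ c ∈ NName.transitiveList, IsomorphicProd μ c.product := by
  have h₂ := h.leftMul_e₂_of_transitive ht
  obtain ⟨a₁, a₂, a₃, ha⟩ := exists_coords (μ e₁ e₁)
  obtain ⟨c₁, c₂, c₃, hc⟩ := exists_coords (μ e₁ e₃)
  obtain ⟨w₁, w₂, w₃, hw⟩ := exists_coords (μ e₃ e₃)
  have hb := h.apply_e₁ e₂
  have hc' := h.apply_e₁ e₃
  have hv := h.apply_e₃_e₂
  rw [hc] at hc'
  simp only [h₂, LinearMap.zero_apply, zero_add] at hb hv
  have r₁ := ht.trace_rightMul e₁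
  have r₃ := ht.trace_rightMul e₃
  have r₁₁ := ht.trace_rightMul_mul e₁ e₁
  have r₃₃ := ht.trace_rightMul_mul e₃ e₃
  have B := h.leftMul_e₁_comm e₃ e₁
  have C := h.leftMul_e₁_comm e₃ e₃
  simp [rightMul, trace_eq, ha, h₂, ← hb, hc, hc', hv, hw, eq_iff_coord] at B C r₁ r₃ r₁₁ r₃₃
  rw [eq_ofMatrix μ]
  simp only [ha, h₂, ← hb, hc, hc', hv, hw, LinearMap.zero_apply]
  obtain rfl : c₃ = -a₁ := by grind
  obtain rfl : w₃ = -c₁ := by grind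
  by_cases ha₃ : a₃ = 0
  · obtain rfl : a₁ = 0 := by grind
    obtain rfl : c₁ = 0 := by grind
    obtain rfl : c₂ = 0 := by grind
    obtain rfl : a₂ = 0 := by grind
    subst ha₃
    by_cases hw₁ : w₁ = 0
    · refine ⟨.n1 0, by simp [NName.transitiveList], isomorphicProd_of_frame 1 (-w₂) 0 1
        one_ne_zero one_ne_zero fun i j => ext fun k => ?_⟩
      rw [ofMatrix_apply, Fin.sum_univ_three, Fin.sum_univ_three, Fin.sum_univ_three,
        Fin.sum_univ_three]
      fin_cases i <;> fin_cases j <;> fin_cases k <;>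
        simp [frameChange, NName.charMatrix, hw₁]
    · refine ⟨.n5, by simp [NName.transitiveList], isomorphicProd_of_frame 1 (-w₂) 0 w₁
        one_ne_zero hw₁ fun i j => ext fun k => ?_⟩
      rw [ofMatrix_apply, Fin.sum_univ_three, Fin.sum_univ_three, Fin.sum_univ_three,
        Fin.sum_univ_three]
      fin_cases i <;> fin_cases j <;> fin_cases k <;>
        simp [frameChange, NName.charMatrix]
  -- The new `e₃` is `(e₁e₁) / a₃`, and `d² = 1 / a₃` makes the rescaled `e₁` square to it.
  · obtain ⟨d, hd⟩ := IsAlgClosed.exists_pow_nat_eq (a₃⁻¹) two_pos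
    have hd₀ : d ≠ 0 := by rintro rfl; simp [eq_comm, ha₃] at hd
    refine ⟨.n10, by simp [NName.transitiveList], isomorphicProd_of_frame 1 (a₂ / a₃) (a₁ / a₃) d
      one_ne_zero hd₀ fun i j => ext fun k => ?_⟩
    have hd₁ : d ^ 2 * a₃ = 1 := by rw [hd, inv_mul_cancel₀ ha₃]
    rw [ofMatrix_apply, Fin.sum_univ_three, Fin.sum_univ_three, Fin.sum_univ_three,
      Fin.sum_univ_three]
    fin_cases i <;> fin_cases j <;> fin_cases k <;>
      simp [frameChange, NName.charMatrix] <;> grind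

end IsLeftSymmetricOn

/-! ### Completeness of the Novikov, bi-symmetric and associative lists -/

namespace IsLeftSymmetricOn

variable {μ : LieN →ₗ[ℂ] LieN →ₗ[ℂ] LieN}

theorem isomorphic_of_novikov (h : IsLeftSymmetricOn μ) (hN : IsNovikovProd μ) :
    ∃ c ∈ NName.novikovList, IsomorphicProd μ c.product := by
  obtain ⟨s, p, l, w₁, w₂, rfl, hsp⟩ := h.eq_splitTable_of_novikov hN
  obtain ⟨s', p', w₁', w₂', hiso, h₁, h₂⟩ := splitTable_normalForm (l := l) (w₂ := w₂) hsp
  suffices ∃ c ∈ NName.novikovList, c.charMatrix = splitTable s' p' l l w₁' w₂' by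
    obtain ⟨c, hc, hM⟩ := this
    exact ⟨c, hc, by rwa [NName.product, hM]⟩
  -- Here `κ = l`, so resonance occurs only at `l = -1`.
  have hl : l = 2 * l + 1 ↔ l = -1 := by grind
  rw [hl] at h₂
  have h0 : (0 : ℂ) ≠ -1 := by simp
  obtain ⟨rfl, rfl, rfl⟩ | ⟨rfl, rfl, hl, rfl⟩ | ⟨rfl, rfl, rfl | ⟨rfl, rfl⟩⟩ := h₁ <;>
    obtain rfl | ⟨rfl, hl₁⟩ := h₂
  · by_cases hl : l = 0
    · exact ⟨.n4 0, by simp [NName.novikovList], by simp [NName.charMatrix, splitTable, hl]⟩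
    · exact ⟨.n26 l, by simp [NName.novikovList, hl], by simp [NName.charMatrix, splitTable]⟩
  · subst hl₁
    exact ⟨.n27, by simp [NName.novikovList], by simp [NName.charMatrix, splitTable, add_comm]⟩
  · exact ⟨.n38 p', by simp [NName.novikovList, hl], by simp [NName.charMatrix, splitTable]⟩
  · subst hl₁
    exact ⟨.n39, by simp [NName.novikovList], by simp [NName.charMatrix, splitTable, add_comm]⟩
  · by_cases hl : l = 0
    · exact ⟨.n1 0, by simp [NName.novikovList], by simp [NName.charMatrix, splitTable, hl]⟩
    · exact ⟨.n18 l, by simp [NName.novikovList, hl], by simp [NName.charMatrix, splitTable]⟩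
  · subst hl₁
    exact ⟨.n19, by simp [NName.novikovList], by simp [NName.charMatrix, splitTable, add_comm]⟩
  · exact ⟨.n5, by simp [NName.novikovList], by simp [NName.charMatrix, splitTable]⟩
  · exact absurd hl₁ h0

theorem isomorphic_of_bisymmetric (h : IsLeftSymmetricOn μ) (hB : IsBisymmetricProd μ) :
    ∃ c ∈ NName.bisymmetricList, IsomorphicProd μ c.product := by
  obtain ⟨s, p, l, w₁, w₂, rfl, hl, hsp⟩ | ⟨t, l, w₁, w₂, rfl, ht, hw⟩ :=
    h.eq_table_of_bisymmetric hB
  · obtain ⟨s', p', w₁', w₂', hiso, h₁, h₂⟩ := splitTable_normalForm (l := l) (w₂ := w₂) hsp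
    suffices ∃ c ∈ NName.bisymmetricList,
        c.charMatrix = splitTable s' p' l (2 * l + 1) w₁' w₂' by
      obtain ⟨c, hc, hM⟩ := this
      exact ⟨c, hc, by rwa [NName.product, hM]⟩
    -- For `l = 0` or `l = -1` the value `κ = 2l + 1` is `±1`, so the exceptional form with `κ = 0`
    -- is absent; resonance always holds.
    have h₁' : s' = 1 ∧ p' = 0 ∧ w₁' = 0 ∨ s' = 0 ∧ p' = 2 * l + 1 ∧ w₁' = 0 ∨
      s' = 0 ∧ p' = 0 ∧ w₁' = 0 := by grind
    have h₂' : w₂' = 0 ∨ w₂' = 1 := by tauto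
    have e : (-2 : ℂ) + 1 = -1 := by norm_num
    clear h₁ h₂ hiso hsp h hB
    obtain ⟨rfl, rfl, rfl⟩ | ⟨rfl, rfl, rfl⟩ | ⟨rfl, rfl, rfl⟩ := h₁' <;>
      obtain rfl | rfl := h₂' <;> obtain rfl | rfl := hl
    · exact ⟨.n3 1, by simp [NName.bisymmetricList], by simp [NName.charMatrix, splitTable]⟩
    · exact ⟨.n26 (-1), by simp [NName.bisymmetricList], by
        simp [NName.charMatrix, splitTable, e]⟩
    · exact ⟨.n7, by simp [NName.bisymmetricList], by
        simp [NName.charMatrix, splitTable, add_comm]⟩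
    · exact ⟨.n27, by simp [NName.bisymmetricList], by
        simp [NName.charMatrix, splitTable, e, add_comm (-e₃)]⟩
    · exact ⟨.n9 1, by simp [NName.bisymmetricList], by simp [NName.charMatrix, splitTable]⟩
    · exact ⟨.n38 (-1), by simp [NName.bisymmetricList], by
        simp [NName.charMatrix, splitTable, e]⟩
    · exact ⟨.n15, by simp [NName.bisymmetricList], by
        simp [NName.charMatrix, splitTable, add_comm]⟩
    · exact ⟨.n39, by simp [NName.bisymmetricList], by
        simp [NName.charMatrix, splitTable, e, add_comm (-e₃)]⟩
    · exact ⟨.n1 1, by simp [NName.bisymmetricList], by simp [NName.charMatrix, splitTable]⟩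
    · exact ⟨.n18 (-1), by simp [NName.bisymmetricList], by
        simp [NName.charMatrix, splitTable, e]⟩
    · exact ⟨.n6, by simp [NName.bisymmetricList], by
        simp [NName.charMatrix, splitTable, add_comm]⟩
    · exact ⟨.n19, by simp [NName.bisymmetricList], by
        simp [NName.charMatrix, splitTable, e, add_comm (-e₃)]⟩
  · by_cases hw₂ : w₂ = 0
    · refine ⟨.n22 1 1, by simp [NName.bisymmetricList], ?_⟩
      have := unitalTable_isomorphic (w₂' := 0) ht one_ne_zero hw ((mul_zero 1).trans hw₂.symm)
      rwa [NName.product, show (NName.n22 1 1).charMatrix = unitalTable 1 0 0 0 by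
        simp [NName.charMatrix, unitalTable]]
    · refine ⟨.n31, by simp [NName.bisymmetricList], ?_⟩
      have := unitalTable_isomorphic (w₂' := 1) ht hw₂ hw (mul_one _)
      rwa [NName.product, show NName.n31.charMatrix = unitalTable 1 0 0 1 by
        simp [NName.charMatrix, unitalTable, add_comm]]

theorem isomorphic_of_associative (h : IsLeftSymmetricOn μ) (hA : IsAssociativeProd μ) :
    ∃ c ∈ NName.associativeList, IsomorphicProd μ c.product := by
  obtain ⟨c, hc, F, hF⟩ := h.isomorphic_of_bisymmetric hA.isBisymmetricProd
  have hc' : c.Admissible := by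
    obtain rfl | rfl | rfl | rfl | rfl | rfl | rfl | rfl | rfl | rfl | rfl | rfl | rfl | rfl := hc
      <;> simp [NName.Admissible]
  refine ⟨c, (c.isAssociativeProd_iff hc').1 ?_, F, hF⟩
  have : IsomorphicProd c.product μ := ⟨F.symm, fun x y => by simp [LinearEquiv.symm_apply_eq, hF]⟩
  exact this.isAssociativeProd hA

/-! ### A proper nonzero ideal containing `e₂` -/

theorem pow_e₂_mul (h : IsLeftSymmetricOn μ) (n : ℕ) :
    (μ e₃ : Module.End ℂ LieN) * (μ e₂ : Module.End ℂ LieN) ^ n =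
      (μ e₂ : Module.End ℂ LieN) ^ n * μ e₃ + (n : ℂ) • (μ e₂ : Module.End ℂ LieN) ^ n := by
  have h₁ := h.leftMul_lie e₃ e₂
  rw [bracket_e₃_e₂] at h₁
  generalize (μ e₃ : Module.End ℂ LieN) = A at *
  generalize (μ e₂ : Module.End ℂ LieN) = B at *
  have h₂ : A * B = B * A + B := by rw [eq_comm, add_comm, ← eq_sub_iff_add_eq]; exact h₁
  induction n with
  | zero => simp
  | succ n ih =>
    rw [pow_succ, ← mul_assoc, ih, add_mul, mul_assoc, h₂, mul_add, ← mul_assoc, Nat.cast_succ,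
      add_smul, one_smul, smul_mul_assoc]
    abel

/-- The left multiplication by `e₂` is nilpotent. -/
theorem isNilpotent_leftMul_e₂ (h : IsLeftSymmetricOn μ) :
    IsNilpotent (μ e₂ : Module.End ℂ LieN) := by
  by_contra hn
  have hn' : ∀ n : ℕ, (μ e₂ : Module.End ℂ LieN) ^ n ≠ 0 := fun n hn' => hn ⟨n, hn'⟩
  -- If no power of `L_{e₂}` vanished, `L_{e₂} ^ n` would be an eigenvector of the commutator with
  -- `L_{e₃}` for each eigenvalue `n`, too many in finite dimension.
  let D : Module.End ℂ (Module.End ℂ LieN) :=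
    LinearMap.mulLeft ℂ (μ e₃ : Module.End ℂ LieN) - LinearMap.mulRight ℂ (μ e₃ : Module.End ℂ LieN)
  have hD : ∀ n : ℕ, D.HasEigenvalue (n : ℂ) := fun n => by
    refine Module.End.hasEigenvalue_of_hasEigenvector
      (x := (μ e₂ : Module.End ℂ LieN) ^ n) ⟨Module.End.mem_eigenspace_iff.2 ?_, hn' n⟩
    simp only [D, LinearMap.sub_apply, LinearMap.mulLeft_apply, LinearMap.mulRight_apply]
    rw [h.pow_e₂_mul, add_sub_cancel_left]
  have : FiniteDimensional ℂ LieN := basis.finiteDimensional_of_finite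
  have := D.finite_hasEigenvalue
  exact Set.infinite_of_injective_forall_mem (f := fun n : ℕ => (n : ℂ)) Nat.cast_injective hD this

theorem leftMul_e₂_cube (h : IsLeftSymmetricOn μ) (x : LieN) : μ e₂ (μ e₂ (μ e₂ x)) = 0 := by
  have : FiniteDimensional ℂ LieN := basis.finiteDimensional_of_finite
  have hf : Module.finrank ℂ LieN = 3 := by
    rw [Module.finrank_eq_card_basis basis, Fintype.card_fin]
  have h₁ := LinearMap.aeval_self_charpoly (μ e₂ : Module.End ℂ LieN)
  rw [h.isNilpotent_leftMul_e₂.charpoly_eq_X_pow_finrank, hf, map_pow, Polynomial.aeval_X] at h₁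
  exact LinearMap.congr_fun h₁ x

/-- The subspace contains all brackets, so left and right ideals coincide for it; stability under
`L_x` follows from `[L_x, L_{e₂}]` being a multiple of `L_{e₂}`. -/
theorem isIdealProd_e₂ (h : IsLeftSymmetricOn μ) :
    IsIdealProd μ (ℂ ∙ e₂ ⊔ LinearMap.range (μ e₂)) := by
  set I := ℂ ∙ e₂ ⊔ LinearMap.range (μ e₂)
  have he : e₂ ∈ I := Submodule.mem_sup_left (Submodule.mem_span_singleton_self _)
  have hr : ∀ x, μ e₂ x ∈ I := fun x => Submodule.mem_sup_right ⟨x, rfl⟩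
  have hb : ∀ x y : LieN, ⁅x, y⁆ ∈ I := fun x y => by
    rw [bracket_def]; exact I.smul_mem _ he
  have hl : ∀ x, ∀ y ∈ I, μ x y ∈ I := by
    intro x y hy
    obtain ⟨z, hz, w, ⟨w, rfl⟩, rfl⟩ := Submodule.mem_sup.1 hy
    obtain ⟨a, rfl⟩ := Submodule.mem_span_singleton.1 hz
    rw [map_add, map_smul]
    refine I.add_mem (I.smul_mem _ ?_) ?_
    · rw [h.eq_add_lie]
      exact I.add_mem (hr _) (hb _ _)
    · have := LinearMap.congr_fun (h.leftMul_lie x e₂) w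
      simp only [LinearMap.sub_apply, Module.End.mul_apply] at this
      rw [← sub_add_cancel (μ x (μ e₂ w)) (μ e₂ (μ x w)), ← this, bracket_def, map_smul]
      exact I.add_mem (I.smul_mem _ (hr _)) (hr _)
  intro x y hy
  refine ⟨hl x y hy, ?_⟩
  rw [h.eq_add_lie]
  exact I.add_mem (hl x y hy) (hb _ _)

theorem ideal_e₂_ne_top (h : IsLeftSymmetricOn μ) : ℂ ∙ e₂ ⊔ LinearMap.range (μ e₂) ≠ ⊤ := by
  intro htop
  have hex : ∀ x, ∃ (a : ℂ) (y : LieN), x = a • e₂ + μ e₂ y := fun x => by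
    have hx : x ∈ ℂ ∙ e₂ ⊔ LinearMap.range (μ e₂) := htop ▸ Submodule.mem_top
    obtain ⟨z, hz, w, ⟨w, rfl⟩, rfl⟩ := Submodule.mem_sup.1 hx
    obtain ⟨a, rfl⟩ := Submodule.mem_span_singleton.1 hz
    exact ⟨a, w, rfl⟩
  have hcube := h.leftMul_e₂_cube e₂
  -- Iterating `x = a • e₂ + e₂y` three times and using `L_{e₂}³ = 0` shows that `e₂` is cyclic for
  -- `L_{e₂}`.
  have hspan : ∀ x, ∃ a b c : ℂ, x = a • e₂ + b • μ e₂ e₂ + c • μ e₂ (μ e₂ e₂) := fun x => by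
    obtain ⟨a, y, hx⟩ := hex x
    obtain ⟨b, z, hy⟩ := hex y
    obtain ⟨c, w, hz⟩ := hex z
    refine ⟨a, b, c, ?_⟩
    rw [hx, hy, hz]
    simp [h.leftMul_e₂_cube, add_assoc]
  have hk : μ e₂ (μ e₂ e₂) ≠ 0 := by
    intro hk
    classical
    have htop' : Submodule.span ℂ (({e₂, μ e₂ e₂} : Finset LieN) : Set LieN) = ⊤ := by
      refine eq_top_iff.2 fun x _ => ?_
      obtain ⟨a, b, c, rfl⟩ := hspan x
      rw [hk, smul_zero, add_zero, Finset.coe_pair]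
      exact Submodule.mem_span_pair.2 ⟨a, b, rfl⟩
    have h₁ := finrank_span_finset_le_card (R := ℂ) ({e₂, μ e₂ e₂} : Finset LieN)
    rw [Set.finrank, htop', finrank_top, Module.finrank_eq_card_basis basis, Fintype.card_fin] at h₁
    exact absurd (h₁.trans Finset.card_le_two) (by norm_num)
  obtain ⟨a, b, c, h₁⟩ := hspan e₁
  obtain ⟨a', b', c', h₃⟩ := hspan e₃
  have hL₃ : ∀ x, μ e₃ (μ e₂ x) = μ e₂ (μ e₃ x) + μ e₂ x := fun x => by
    have := LinearMap.congr_fun (h.leftMul_lie e₃ e₂) x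
    simp only [bracket_e₃_e₂, LinearMap.sub_apply, Module.End.mul_apply] at this
    exact sub_eq_iff_eq_add'.1 this.symm
  set g := μ e₂ e₂
  set k := μ e₂ g
  have L₁f : μ e₁ e₂ = a • g + b • k := by
    rw [← h.apply_e₁]
    conv_lhs => rw [h₁]
    simp [g, k, hcube]
  have L₁g : μ e₁ g = a • k := by
    simp only [g, h.leftMul_e₁_comm, L₁f, map_add, map_smul]
    simp [k, g, hcube]
  have L₁k : μ e₁ k = 0 := by
    rw [h.leftMul_e₁_comm, L₁g, map_smul, hcube, smul_zero]
  have L₃f : μ e₃ e₂ = e₂ + a' • g + b' • k := by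
    rw [h.apply_e₃_e₂]
    conv_lhs => rw [h₃]
    simp only [map_add, map_smul, hcube, smul_zero, add_zero]
    simp only [g, k]
    abel
  have L₃g : μ e₃ g = (2 : ℂ) • g + a' • k := by
    rw [hL₃, L₃f]
    simp only [map_add, map_smul, hcube]
    module
  have L₃k : μ e₃ k = (3 : ℂ) • k := by
    rw [hL₃, L₃g]
    simp only [map_add, map_smul, hcube]
    module
  -- On the chain `e₂`, `g`, `k` the operator `L_{e₃}` is triangular with diagonal `1`, `2`, `3`,
  -- while `L_{e₁}` strictly raises; commutation therefore forces `a = b = 0`.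
  have hcomm := h.leftMul_e₁_comm e₃ e₂
  rw [L₁f, L₃f] at hcomm
  simp only [map_add, map_smul, L₁f, L₁g, L₁k, L₃g, L₃k] at hcomm
  have hab : a • g + (2 * b) • k = 0 := by linear_combination (norm := module) -hcomm
  have ha : a = 0 := by
    have := congrArg (μ e₂) hab
    simp only [map_add, map_smul, hcube, smul_zero, add_zero, map_zero] at this
    exact (smul_eq_zero.1 this).resolve_right hk
  have hb : b = 0 := by
    rw [ha, zero_smul, zero_add, smul_eq_zero] at hab
    simpa using hab.resolve_right hk
  have h₄ : μ e₃ e₁ = 0 := by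
    rw [h.apply_e₁, h₃]
    simp only [map_add, map_smul, L₁f, L₁g, L₁k, ha, hb]
    simp
  rw [ha, hb] at h₁
  rw [h₁] at h₄
  -- Now `e₁ = c • k`, and `e₃k = 3k` while `e₃e₁ = 0`.
  simp only [map_smul, L₃k, zero_smul, zero_add, smul_eq_zero] at h₄
  have hc : c = 0 := h₄.resolve_right (by simp [hk])
  have : e₁ = 0 := by rw [h₁, hc]; simp
  simpa using congrArg (coord · 0) this

theorem not_isSimpleProd (h : IsLeftSymmetricOn μ) : ¬ IsSimpleProd μ := by
  rintro ⟨-, hs⟩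
  obtain hI | hI := hs _ h.isIdealProd_e₂
  · have he : e₂ ∈ (⊥ : Submodule ℂ LieN) :=
      hI ▸ Submodule.mem_sup_left (Submodule.mem_span_singleton_self _)
    simpa using congrArg (coord · 1) ((Submodule.mem_bot ℂ).1 he)
  · exact h.ideal_e₂_ne_top hI

end IsLeftSymmetricOn

/-! ### Semisimplicity of `n30` -/

/-- Simplicity of an ideal is tested on subspaces of the ambient space, which avoids computing in
the subtype. -/
theorem isSimpleProd_idealProd {k V : Type*} [Field k] [AddCommGroup V] [Module k V]
    {μ : V →ₗ[k] V →ₗ[k] V} {I : Submodule k V} (hI : IsIdealProd μ I) (hne : ∃ x ∈ I, x ≠ 0)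
    (h : ∀ K : Submodule k V,
      (∀ x ∈ I, ∀ y ∈ K, μ x y ∈ K ∧ μ y x ∈ K) →
        (∃ y ∈ I, y ∈ K ∧ y ≠ 0) → I ≤ K) :
    IsSimpleProd (idealProd μ I hI) := by
  obtain ⟨x, hx, hx₀⟩ := hne
  refine ⟨⟨⟨x, hx⟩, 0, fun h => hx₀ (congrArg Subtype.val h)⟩, fun K hK => ?_⟩
  refine or_iff_not_imp_left.2 fun hK₀ => ?_
  obtain ⟨y, hy, hy₀⟩ := Submodule.exists_mem_ne_zero_of_ne_bot hK₀
  have := h (K.map I.subtype) (fun x hx z hz => ?_)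
    ⟨y, y.2, Submodule.mem_map_of_mem hy, fun h => hy₀ (Subtype.ext h)⟩
  · refine eq_top_iff.2 fun z _ => ?_
    obtain ⟨w, hw, hwz⟩ := this z.2
    rwa [← Subtype.ext hwz]
  · obtain ⟨w, hw, rfl⟩ := hz
    exact ⟨⟨_, (hK ⟨x, hx⟩ w hw).1, rfl⟩, ⟨_, (hK ⟨x, hx⟩ w hw).2, rfl⟩⟩

namespace NName

theorem product_n30_apply (x y : LieN) :
    n30.product x y = (coord x 0 * coord y 0) • e₁ + (coord x 2 * coord y 1) • e₂ +
      (coord x 1 * coord y 1 + 2 * (coord x 2 * coord y 2)) • e₃ := by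
  rw [product, ofMatrix_apply, Fin.sum_univ_three, Fin.sum_univ_three, Fin.sum_univ_three,
    Fin.sum_univ_three]
  simp [charMatrix]
  module

/-- The plane spanned by `e₂` and `e₃`. -/
noncomputable def planeIdeal : Submodule ℂ LieN :=
  LinearMap.ker (LinearMap.proj 0 ∘ₗ coord.toLinearMap : LieN →ₗ[ℂ] ℂ)

theorem mem_planeIdeal {x : LieN} : x ∈ planeIdeal ↔ coord x 0 = 0 := by simp [planeIdeal]

theorem isIdealProd_line : IsIdealProd n30.product (ℂ ∙ e₁) := by
  intro x y hy
  obtain ⟨a, rfl⟩ := Submodule.mem_span_singleton.1 hy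
  simp [product_n30_apply, Submodule.smul_mem, Submodule.mem_span_singleton_self]

theorem isIdealProd_plane : IsIdealProd n30.product planeIdeal := by
  intro x y hy
  rw [mem_planeIdeal] at hy
  simp [product_n30_apply, mem_planeIdeal, hy]

theorem isCompl_line_plane : IsCompl (ℂ ∙ e₁) planeIdeal := by
  rw [isCompl_iff, Submodule.disjoint_def, codisjoint_iff, eq_top_iff]
  constructor
  · intro x hx hx'
    obtain ⟨a, rfl⟩ := Submodule.mem_span_singleton.1 hx
    rw [mem_planeIdeal] at hx'
    simp at hx'
    simp [hx']
  · intro x _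
    rw [eq_sum_coord x, add_assoc]
    refine Submodule.add_mem_sup (Submodule.smul_mem _ _ (Submodule.mem_span_singleton_self _)) ?_
    simp [mem_planeIdeal]

theorem isSimpleProd_line : IsSimpleProd (idealProd n30.product (ℂ ∙ e₁) isIdealProd_line) := by
  have he₁ : e₁ ≠ 0 := fun h => by simpa using congrArg (coord · 0) h
  refine isSimpleProd_idealProd _ ⟨e₁, Submodule.mem_span_singleton_self _, he₁⟩
    fun K _ ⟨y, hy, hyK, hy₀⟩ => ?_
  obtain ⟨a, rfl⟩ := Submodule.mem_span_singleton.1 hy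
  have ha : a ≠ 0 := fun h => hy₀ (by simp [h])
  rw [Submodule.span_singleton_le_iff_mem]
  exact (K.smul_mem_iff ha).1 hyK

theorem isSimpleProd_plane :
    IsSimpleProd (idealProd n30.product planeIdeal isIdealProd_plane) := by
  have he₃ : e₃ ≠ 0 := fun h => by simpa using congrArg (coord · 2) h
  have h₂ : e₂ ∈ planeIdeal := by simp [mem_planeIdeal]
  have h₃ : e₃ ∈ planeIdeal := by simp [mem_planeIdeal]
  refine isSimpleProd_idealProd _ ⟨e₃, h₃, he₃⟩ fun K hK ⟨y, hy, hyK, hy₀⟩ => ?_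
  rw [mem_planeIdeal] at hy
  have k₂ := (hK _ h₂ _ hyK).1
  have k₃ := (hK _ h₃ _ hyK).1
  simp only [product_n30_apply, coord_e₂, coord_e₃, hy] at k₂ k₃
  simp at k₂ k₃
  -- With `y = y₁e₂ + y₂e₃` one has `e₂y = y₁e₃`, and `e₃y = 2y₂e₃` when `y₁ = 0`. Afterwards `e₃e₂
  -- = e₂` supplies the other generator.
  have he₃K : e₃ ∈ K := by
    by_cases hy₁ : coord y 1 = 0
    · have hy₂ : coord y 2 ≠ 0 := fun hy₂ => hy₀ (eq_iff_coord.2 (by simp [hy, hy₁, hy₂]))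
      rwa [hy₁, zero_smul, zero_add, K.smul_mem_iff (mul_ne_zero two_ne_zero hy₂)] at k₃
    · rwa [K.smul_mem_iff hy₁] at k₂
  have he₂K : e₂ ∈ K := by simpa [product_n30_apply] using (hK _ h₂ _ he₃K).2
  intro x hx
  rw [mem_planeIdeal] at hx
  rw [eq_sum_coord x, hx, zero_smul, zero_add]
  exact K.add_mem (K.smul_mem _ he₂K) (K.smul_mem _ he₃K)

theorem isSemisimpleProd_n30 : IsSemisimpleProd n30.product := by
  refine ⟨2, ![ℂ ∙ e₁, planeIdeal], fun i => ?_, ?_, fun i => ?_⟩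
  · fin_cases i
    exacts [isIdealProd_line, isIdealProd_plane]
  · rw [DirectSum.isInternal_submodule_iff_isCompl _ (i := 0) (j := 1) (by simp)
      (by ext i; fin_cases i <;> simp)]
    exact isCompl_line_plane
  · fin_cases i
    exacts [isSimpleProd_line, isSimpleProd_plane]

theorem admissible_of_mem {c : NName} (h : c ∈ bisymmetricList ∨ c ∈ associativeList ∨
    c ∈ transitiveList ∨ c ∈ novikovList) : c.Admissible := by
  cases c <;>
    simp [bisymmetricList, associativeList, transitiveList, novikovList, Admissible] at h ⊢ <;>
    grind

end NName

theorem proposition3p8 :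
    -- the named algebras are left-symmetric algebras on `N`, and those with one of the four
    -- properties are exactly the listed ones
    (∀ c : NName, c.Admissible →
      IsLeftSymmetricOn c.product ∧
      (IsAssociativeProd c.product ↔ c ∈ NName.associativeList) ∧
      (IsTransitiveProd c.product ↔ c ∈ NName.transitiveList) ∧
      (IsNovikovProd c.product ↔ c ∈ NName.novikovList) ∧
      (IsBisymmetricProd c.product ↔ c ∈ NName.bisymmetricList)) ∧
    -- up to isomorphism, the lists are complete among all left-symmetric algebras on `N`,
    -- and none of the latter is simple
    (∀ μ : LieN →ₗ[ℂ] LieN →ₗ[ℂ] LieN, IsLeftSymmetricOn μ →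
      (IsAssociativeProd μ ↔ ∃ c ∈ NName.associativeList, IsomorphicProd μ c.product) ∧
      (IsTransitiveProd μ ↔ ∃ c ∈ NName.transitiveList, IsomorphicProd μ c.product) ∧
      (IsNovikovProd μ ↔ ∃ c ∈ NName.novikovList, IsomorphicProd μ c.product) ∧
      (IsBisymmetricProd μ ↔ ∃ c ∈ NName.bisymmetricList, IsomorphicProd μ c.product) ∧
      ¬ IsSimpleProd μ) ∧
    IsSemisimpleProd (NName.product NName.n30) := by
  refine ⟨fun c hc => ⟨c.isLeftSymmetricOn hc, c.isAssociativeProd_iff hc,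
    c.isTransitiveProd_iff hc, c.isNovikovProd_iff hc, c.isBisymmetricProd_iff hc⟩,
    fun μ h => ⟨⟨h.isomorphic_of_associative, ?_⟩, ⟨h.isomorphic_of_transitive, ?_⟩,
      ⟨h.isomorphic_of_novikov, ?_⟩, ⟨h.isomorphic_of_bisymmetric, ?_⟩, h.not_isSimpleProd⟩,
    NName.isSemisimpleProd_n30⟩ <;> rintro ⟨c, hc, hiso⟩
  · exact hiso.isAssociativeProd
      ((c.isAssociativeProd_iff (NName.admissible_of_mem (by tauto))).2 hc)
  · exact hiso.isTransitiveProd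
      ((c.isTransitiveProd_iff (NName.admissible_of_mem (by tauto))).2 hc)
  · exact hiso.isNovikovProd
      ((c.isNovikovProd_iff (NName.admissible_of_mem (by tauto))).2 hc)
  · exact hiso.isBisymmetricProd
      ((c.isBisymmetricProd_iff (NName.admissible_of_mem (by tauto))).2 hc)
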